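/- An independence relation $\perp$ on a category $\mathcal{E}$ is a class of commuting squares in $\mathcal{E}$ (the independent squares). A commuting square with left side $C \to A$, bottom side $C \to B$, top side $A \to M$ and right side $B \to M$ is regarded as a morphism from $(C \to A)$ to $(B \to M)$ in the arrow category $\mathcal{E}^2$. The relation $\perp$ satisfies *basic existence* if every commuting square whose bottom or left side is an isomorphism is independent, and *transitivity* if, whenever two independent squares are placed side by side (the right side of the first being the left side of the second), the outer rectangle is independent. If $\perp$ satisfies both, let $\mathcal{E}_\perp$ be the subcategory of $\mathcal{E}^2$ with all objects of $\mathcal{E}^2$ and with the independent squares as morphisms. We say that $\perp$ *is accessible* if $\mathcal{E}_\perp$ is an accessible category, and that $\perp$ *has the union property* if $\mathcal{E}_\perp$ has directed colimits and the inclusion $\mathcal{E}_\perp \hookrightarrow \mathcal{E}^2$ preserves them. **Theorem.** Let $\mathcal{C}$ and $\mathcal{D}$ be accessible categories having directed colimits, and let $F : \mathcal{C} \to \mathcal{D}$ be a functor that preserves directed colimits. Let $\perp$ be an independence relation on $\mathcal{D}$ that satisfies basic existence and transitivity, and let $F^{-1}(\perp)$ be its lift to $\mathcal{C}$: a commuting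 square in $\mathcal{C}$ is $F^{-1}(\perp)$-independent if and only if its image under $F$ is $\perp$-independent. (The lift again satisfies basic existence and transitivity.) 1. If $\perp$ has the union property, then so does $F^{-1}(\perp)$. 2. If $\perp$ has the union property and is accessible, then $F^{-1}(\perp)$ has the union property and is accessible. -/

import Mathlib

open CategoryTheory CategoryTheory.Limits

universe w v v₁ v₂ u u₁ u₂

/-- A category has directed colimits if every diagram indexed by a (`w`-small, nonempty)
directed poset has a colimit. -/
class HasDirectedColimits (C : Type u) [Category.{v} C] : Prop where
  hasColimitsOfShape (J : Type w) [PartialOrder J] [IsDirectedOrder J] [Nonempty J] :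
    HasColimitsOfShape J C

/-- A functor preserves directed colimits if it preserves all colimits indexed by
(`w`-small, nonempty) directed posets. -/
class PreservesDirectedColimits {C : Type u₁} [Category.{v₁} C] {D : Type u₂} [Category.{v₂} D]
    (F : C ⥤ D) : Prop where
  preservesColimitsOfShape (J : Type w) [PartialOrder J] [IsDirectedOrder J] [Nonempty J] :
    PreservesColimitsOfShape J F

/-- An independence relation on a category `𝒞`: a class of commuting squares
```
  A --am--> M
  ^         ^
  ca        bm
  |         |
  C --cb--> B
```
`Indep ca cb am bm` says that this square is independent, i.e. that `A` is independent from `B`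
over `C` in `M`. -/
@[ext]
structure IndependenceRelation (𝒞 : Type u) [Category.{v} 𝒞] where
  /-- The independent squares. -/
  Indep : ∀ {A B C M : 𝒞}, (C ⟶ A) → (C ⟶ B) → (A ⟶ M) → (B ⟶ M) → Prop
  /-- Independent squares commute. -/
  commSq : ∀ {A B C M : 𝒞} {ca : C ⟶ A} {cb : C ⟶ B} {am : A ⟶ M} {bm : B ⟶ M},
    Indep ca cb am bm → CommSq ca cb am bm

namespace IndependenceRelation

section

variable {𝒞 : Type u} [Category.{v} 𝒞] (I : IndependenceRelation 𝒞)

/-- Basic existence: any commuting square whose bottom or left morphism is an isomorphism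
is independent. -/
class BasicExistence : Prop where
  indep {A B C M : 𝒞} {ca : C ⟶ A} {cb : C ⟶ B} {am : A ⟶ M} {bm : B ⟶ M} :
    CommSq ca cb am bm → (IsIso cb ∨ IsIso ca) → I.Indep ca cb am bm

/-- Transitivity: in a commuting diagram
```
  A --am--> M --mn--> N
  ^         ^         ^
  ca        bm        dn
  |         |         |
  C --cb--> B --bd--> D
```
if both squares are independent, then so is the outer rectangle. -/
class Transitivity : Prop where
  comp {A B C D M N : 𝒞} {ca : C ⟶ A} {cb : C ⟶ B} {am : A ⟶ M} {bm : B ⟶ M}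
    {bd : B ⟶ D} {mn : M ⟶ N} {dn : D ⟶ N} :
    I.Indep ca cb am bm → I.Indep bm bd mn dn → I.Indep ca (cb ≫ bd) (am ≫ mn) dn

/-- The independent squares, as a class of morphisms of the arrow category: a morphism from
`ca : C ⟶ A` to `bm : B ⟶ M` is a commuting square with left side `ca`, right side `bm`,
bottom `C ⟶ B` and top `A ⟶ M`. -/
def squares : MorphismProperty (Arrow 𝒞) :=
  fun f g φ ↦ I.Indep f.hom φ.left φ.right g.hom

instance [I.BasicExistence] [I.Transitivity] : I.squares.IsMultiplicative where
  id_mem f := BasicExistence.indep ⟨by simp⟩ (Or.inl (by dsimp; infer_instance))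
  comp_mem φ ψ hφ hψ := Transitivity.comp (I := I) hφ hψ

/-- The category whose objects are the morphisms of `𝒞` and whose morphisms are the
independent squares. -/
abbrev Cat [I.BasicExistence] [I.Transitivity] := WideSubcategory I.squares

/-- The inclusion of the category of independent squares into the arrow category. -/
abbrev inclusion [I.BasicExistence] [I.Transitivity] : I.Cat ⥤ Arrow 𝒞 :=
  wideSubcategoryInclusion I.squares

/-- The category of independent squares is accessible. -/
def Accessible [I.BasicExistence] [I.Transitivity] : Prop :=
  IsAccessibleCategory.{w} I.Cat

/-- Union: the category of independent squares has directed colimits, and these are preserved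
by the inclusion into the arrow category. -/
def Union [I.BasicExistence] [I.Transitivity] : Prop :=
  HasDirectedColimits.{w} I.Cat ∧ PreservesDirectedColimits.{w} I.inclusion

end

section

variable {𝒞 : Type u₁} [Category.{v₁} 𝒞] {𝒟 : Type u₂} [Category.{v₂} 𝒟]

/-- The lift of an independence relation along a functor `F`: a commuting square is independent
if and only if its image under `F` is. -/
def lift (F : 𝒞 ⥤ 𝒟) (I : IndependenceRelation 𝒟) : IndependenceRelation 𝒞 where
  Indep ca cb am bm :=
    CommSq ca cb am bm ∧ I.Indep (F.map ca) (F.map cb) (F.map am) (F.map bm)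
  commSq h := h.1

instance (F : 𝒞 ⥤ 𝒟) (I : IndependenceRelation 𝒟) [I.BasicExistence] :
    (I.lift F).BasicExistence where
  indep h hi := ⟨h, BasicExistence.indep (h.map F)
    (hi.imp (fun (_ : IsIso _) ↦ inferInstance) (fun (_ : IsIso _) ↦ inferInstance))⟩

instance (F : 𝒞 ⥤ 𝒟) (I : IndependenceRelation 𝒟) [I.Transitivity] :
    (I.lift F).Transitivity where
  comp h₁ h₂ := ⟨h₁.1.flip.horiz_comp h₂.1.flip |>.flip, by
    simpa using Transitivity.comp (I := I) h₁.2 h₂.2⟩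

end

end IndependenceRelation

/-! By `lift_squares`, the category of lifted independent squares is the pullback of `F.mapArrow`
and `I.inclusion` over `Arrow 𝒟`. Basic existence puts every isomorphism of `Arrow 𝒟` among the
independent squares, so this strict pullback behaves like a pseudopullback: colimits in the two
factors with isomorphic images in `Arrow 𝒟` can be glued (`exists_isColimit_map`). This gives the
union property.

For accessibility, choose one uncountable regular `κ` for which `Arrow 𝒞` and `I.Cat` are
`κ`-accessible and both functors to `Arrow 𝒟` preserve `κ`-presentable objects. Directed colimits
make every sufficiently large uncountable regular `κ` suitable: a directed poset is a `κ`-filtered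
union of directed subsets of size `< κ`, so no sharp inequality between cardinals is needed beyond
`ℵ₀ < κ`.

The objects of the pullback that are `κ`-presentable in both factors then generate. Given
`κ`-presentable objects over the two components of an object, a back-and-forth construction yields
two `ω`-chains whose images in `Arrow 𝒟` interleave. Their colimits have isomorphic images, and
remain `κ`-presentable because `κ` is uncountable (`exists_isCardinalPresentable_factorization`).
`JointlyRefines` turns this into density and `κ`-filteredness of the canonical diagrams; it also
proves that arrow categories are accessible. -/

/-! ### Directed and filtered colimits, and colimits of arrows -/

section

variable {C : Type u₁} [Category.{v₁} C] {D : Type u₂} [Category.{v₂} D]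

lemma isDirectedOrder_of_isFiltered (J : Type u) [Preorder J] [IsFiltered J] :
    IsDirectedOrder J :=
  ⟨fun a b ↦ ⟨IsFiltered.max a b, leOfHom (IsFiltered.leftToMax a b),
    leOfHom (IsFiltered.rightToMax a b)⟩⟩

/-- Every small filtered category receives a final functor from a directed poset. -/
lemma HasDirectedColimits.hasColimitsOfShape_of_isFiltered [HasDirectedColimits.{w} C]
    (J : Type u) [Category.{v} J] [EssentiallySmall.{w} J] [IsFiltered J] :
    HasColimitsOfShape J C := by
  have : IsFiltered (SmallModel.{w} J) := IsFiltered.of_equivalence (equivSmallModel.{w} J)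
  obtain ⟨α, _, _, _, G, _⟩ := IsFiltered.exists_directed (SmallModel.{w} J)
  have := HasDirectedColimits.hasColimitsOfShape (C := C) α
  have : HasColimitsOfShape (SmallModel.{w} J) C :=
    Functor.Final.hasColimitsOfShape_of_final G
  exact hasColimitsOfShape_of_equivalence (equivSmallModel.{w} J).symm

lemma PreservesDirectedColimits.preservesColimitsOfShape_of_isFiltered
    (F : C ⥤ D) [PreservesDirectedColimits.{w} F]
    (J : Type u) [Category.{v} J] [EssentiallySmall.{w} J] [IsFiltered J] :
    PreservesColimitsOfShape J F := by
  have : IsFiltered (SmallModel.{w} J) := IsFiltered.of_equivalence (equivSmallModel.{w} J)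
  obtain ⟨α, _, _, _, G, _⟩ := IsFiltered.exists_directed (SmallModel.{w} J)
  have := PreservesDirectedColimits.preservesColimitsOfShape (F := F) α
  have : PreservesColimitsOfShape (SmallModel.{w} J) F :=
    Functor.Final.preservesColimitsOfShape_of_final G F
  exact preservesColimitsOfShape_of_equiv (equivSmallModel.{w} J).symm F

instance [HasDirectedColimits.{w} C] (κ : Cardinal.{w}) [Fact κ.IsRegular] :
    HasCardinalFilteredColimits.{w} C κ where
  hasColimitsOfShape J _ _ :=
    have := isFiltered_of_isCardinalFiltered J κ
    HasDirectedColimits.hasColimitsOfShape_of_isFiltered J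

lemma PreservesDirectedColimits.isCardinalAccessible (F : C ⥤ D)
    [PreservesDirectedColimits.{w} F] (κ : Cardinal.{w}) [Fact κ.IsRegular] :
    F.IsCardinalAccessible κ where
  preservesColimitOfShape J _ _ :=
    have := isFiltered_of_isCardinalFiltered J κ
    preservesColimitsOfShape_of_isFiltered F J

instance essentiallySmall_nat : EssentiallySmall.{w} ℕ :=
  essentiallySmall_of_small_of_locallySmall.{w} ℕ

/-- A cocone in an arrow category is colimiting if its two components are. -/
noncomputable def CategoryTheory.Arrow.isColimitOfLeftRight {J : Type u} [Category.{v} J]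
    {K : J ⥤ Arrow C} {c : Cocone K} (h₁ : IsColimit (Arrow.leftFunc.mapCocone c))
    (h₂ : IsColimit (Arrow.rightFunc.mapCocone c)) : IsColimit c :=
  Comma.fstSndJointlyReflectColimit h₁ h₂

instance [HasDirectedColimits.{w} C] : HasDirectedColimits.{w} (Arrow C) where
  hasColimitsOfShape J _ _ _ :=
    have := HasDirectedColimits.hasColimitsOfShape (C := C) J
    inferInstance

lemma CategoryTheory.Functor.mapArrow_preservesColimitsOfShape (J : Type u) [Category.{v} J]
    [HasColimitsOfShape J C] (F : C ⥤ D) [PreservesColimitsOfShape J F] :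
    PreservesColimitsOfShape J F.mapArrow where
  preservesColimit := ⟨fun hc ↦ ⟨Arrow.isColimitOfLeftRight
    (isColimitOfPreserves F (isColimitOfPreserves Arrow.leftFunc hc))
    (isColimitOfPreserves F (isColimitOfPreserves Arrow.rightFunc hc))⟩⟩

instance [HasDirectedColimits.{w} C] (F : C ⥤ D) [PreservesDirectedColimits.{w} F] :
    PreservesDirectedColimits.{w} F.mapArrow where
  preservesColimitsOfShape J _ _ _ :=
    have := HasDirectedColimits.hasColimitsOfShape (C := C) J
    have := PreservesDirectedColimits.preservesColimitsOfShape (F := F) J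
    F.mapArrow_preservesColimitsOfShape J

end

/-! ### Colimits in a pulled back wide subcategory -/

namespace CategoryTheory.WideSubcategory

variable {E : Type u₁} [Category.{v₁} E] {B : Type u₂} [Category.{v₂} B] (G : E ⥤ B)
  {W : MorphismProperty B} [W.IsMultiplicative] {W' : MorphismProperty E} [W'.IsMultiplicative]

/-- The functor between wide subcategories induced by a functor. -/
def map (h : W' ≤ W.inverseImage G) : WideSubcategory W' ⥤ WideSubcategory W where
  obj X := ⟨G.obj X.obj⟩
  map f := ⟨G.map f.1, h _ f.2⟩

variable {G} (h : W' = W.inverseImage G)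

section

variable {J : Type u} [Category.{v} J]

/-- A cocone in a pulled back wide subcategory is colimiting as soon as its images in both
factors of the pullback are. -/
noncomputable def isColimitOfMap {K : J ⥤ WideSubcategory W'} {c : Cocone K}
    [PreservesColimit (K ⋙ wideSubcategoryInclusion W') G]
    (h₁ : IsColimit ((wideSubcategoryInclusion W').mapCocone c))
    (h₂ : IsColimit ((map G h.le).mapCocone c)) : IsColimit c where
  desc s := ⟨h₁.desc ((wideSubcategoryInclusion W').mapCocone s), by
    -- The morphism induced in `E` lies in `W'` because its image is the morphism induced in the
    -- wide subcategory of `W`; the two agree on the colimit preserved by `G`.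
    have : G.map (h₁.desc ((wideSubcategoryInclusion W').mapCocone s)) =
        (h₂.desc ((map G h.le).mapCocone s)).1 := by
      refine (isColimitOfPreserves G h₁).hom_ext fun j ↦ ?_
      have e₁ := congr_arg G.map (h₁.fac ((wideSubcategoryInclusion W').mapCocone s) j)
      have e₂ := congr_arg InducedWideCategory.Hom.hom
        (h₂.fac ((map G h.le).mapCocone s) j)
      rw [G.map_comp] at e₁
      exact e₁.trans e₂.symm
    have hs : W (G.map (h₁.desc ((wideSubcategoryInclusion W').mapCocone s))) := by
      rw [this]
      exact (h₂.desc ((map G h.le).mapCocone s)).2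
    exact h.ge _ hs⟩
  fac s j := WideSubcategory.hom_ext _
    (h₁.fac ((wideSubcategoryInclusion W').mapCocone s) j)
  uniq s m hm := WideSubcategory.hom_ext _
    (h₁.uniq ((wideSubcategoryInclusion W').mapCocone s) m.1
      fun j ↦ congr_arg InducedWideCategory.Hom.hom (hm j))

include h in
-- Both colimits become colimits of the same diagram in `B`, hence are identified there by an
-- isomorphism `φ`. As `φ` is in `W`, the legs of the colimit in `E` are in `W'`, and `φ` transports
-- the colimit property in the other factor.
lemma exists_isColimit_map (hW : MorphismProperty.isomorphisms B ≤ W)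
    (K : J ⥤ WideSubcategory W')
    [HasColimit (K ⋙ wideSubcategoryInclusion W')]
    [PreservesColimit (K ⋙ wideSubcategoryInclusion W') G]
    [HasColimit (K ⋙ map G h.le)]
    [PreservesColimit (K ⋙ map G h.le) (wideSubcategoryInclusion W)] :
    ∃ (c : Cocone K), Nonempty (IsColimit ((wideSubcategoryInclusion W').mapCocone c)) ∧
      Nonempty (IsColimit ((map G h.le).mapCocone c)) := by
  let cE := colimit.cocone (K ⋙ wideSubcategoryInclusion W')
  have hE : IsColimit cE := colimit.isColimit _
  let cA := colimit.cocone (K ⋙ map G h.le)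
  have hA : IsColimit cA := colimit.isColimit _
  let φ : cA.pt.obj ≅ G.obj cE.pt :=
    (isColimitOfPreserves (wideSubcategoryInclusion W) hA).coconePointUniqueUpToIso
      (isColimitOfPreserves G hE)
  have hφ (j : J) : (cA.ι.app j).1 ≫ φ.hom = G.map (cE.ι.app j) :=
    (isColimitOfPreserves (wideSubcategoryInclusion W) hA).comp_coconePointUniqueUpToIso_hom
      (isColimitOfPreserves G hE) j
  have hφ₁ : W φ.hom := hW _ (inferInstanceAs (IsIso φ.hom))
  have hφ₂ : W φ.inv := hW _ (inferInstanceAs (IsIso φ.inv))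
  let c : Cocone K :=
    { pt := ⟨cE.pt⟩
      ι :=
        { app j := ⟨cE.ι.app j, by
            have hj : W (G.map (cE.ι.app j)) := by
              rw [← hφ j]
              exact W.comp_mem _ _ (cA.ι.app j).2 hφ₁
            exact h.ge _ hj⟩
          naturality i j f := WideSubcategory.hom_ext _ (cE.ι.naturality f) } }
  refine ⟨c, ⟨IsColimit.ofIsoColimit hE (Cocone.ext (Iso.refl _) fun _ ↦ Category.comp_id _)⟩,
    ⟨IsColimit.ofIsoColimit hA (Cocone.ext (WideSubcategory.isoMk φ hφ₁ hφ₂) fun j ↦ ?_)⟩⟩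
  exact WideSubcategory.hom_ext _ (hφ j)

variable (J) [HasColimitsOfShape J E] [PreservesColimitsOfShape J G]
  [HasColimitsOfShape J (WideSubcategory W)]
  [PreservesColimitsOfShape J (wideSubcategoryInclusion W)]
  (hW : MorphismProperty.isomorphisms B ≤ W)

include h hW

lemma hasColimitsOfShape_of_eq_inverseImage : HasColimitsOfShape J (WideSubcategory W') where
  has_colimit K := by
    obtain ⟨c, ⟨h₁⟩, ⟨h₂⟩⟩ := exists_isColimit_map h hW K
    exact ⟨⟨c, isColimitOfMap h h₁ h₂⟩⟩

lemma preservesColimitsOfShape_inclusion_of_eq_inverseImage :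
    PreservesColimitsOfShape J (wideSubcategoryInclusion W') where
  preservesColimit {K} := by
    obtain ⟨c, ⟨h₁⟩, ⟨h₂⟩⟩ := exists_isColimit_map h hW K
    exact preservesColimit_of_preserves_colimit_cocone (isColimitOfMap h h₁ h₂) h₁

lemma preservesColimitsOfShape_map_of_eq_inverseImage :
    PreservesColimitsOfShape J (map G h.le) where
  preservesColimit {K} := by
    obtain ⟨c, ⟨h₁⟩, ⟨h₂⟩⟩ := exists_isColimit_map h hW K
    exact preservesColimit_of_preserves_colimit_cocone (isColimitOfMap h h₁ h₂) h₂

end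

end CategoryTheory.WideSubcategory

/-! ### Directed colimits as `κ`-filtered colimits of small directed colimits -/

section

open Cardinal

lemma HasCardinalLT.finset {X : Type u} {κ : Cardinal.{w}} (h : HasCardinalLT X κ)
    (hκ : ℵ₀ ≤ κ) : HasCardinalLT (Finset X) κ := by
  cases finite_or_infinite X
  · exact hasCardinalLT_of_finite _ _ hκ
  · simpa only [HasCardinalLT, mk_finset_of_infinite] using h

/-- This is the relation `ℵ₀ ◁ κ`, valid for every uncountable regular `κ`. -/
lemma HasCardinalLT.exists_directed_superset {X : Type w} [PartialOrder X] [IsDirectedOrder X]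
    [Nonempty X] {κ : Cardinal.{w}} [Fact κ.IsRegular] (hκ : ℵ₀ < κ)
    (A : Set X) (hA : HasCardinalLT A κ) :
    ∃ (B : Set X), A ⊆ B ∧ Nonempty B ∧ IsDirectedOrder B ∧ HasCardinalLT B κ := by
  have := fact_isRegular_aleph0.{w}
  have : IsCardinalFiltered X ℵ₀ := (isCardinalFiltered_aleph0_iff.{w} X).2 inferInstance
  obtain ⟨B, hAB, _, hB⟩ :=
    Cardinal.SharplyLT.exists_isCardinalFiltered_set_of_exists_cofinal hκ (fun Y hY ↦ by
      -- The cofinal family consists of all finite subsets of `Y`; there are fewer than `κ` of them.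
      refine ⟨Set.univ, ?_, fun y ↦ ⟨y, Set.mem_univ _, le_rfl⟩⟩
      refine (hY.finset hκ.le).of_surjective (fun s ↦ ⟨⟨(s : Set Y),
        hasCardinalLT_of_finite _ _ le_rfl⟩, Set.mem_univ _⟩) ?_
      rintro ⟨⟨s, hs⟩, _⟩
      have hs : s.Finite := (hasCardinalLT_aleph0_iff _).1 hs
      exact ⟨hs.toFinset, by simp⟩) A hA
  have := isFiltered_of_isCardinalFiltered B ℵ₀
  exact ⟨B, hAB, IsFiltered.nonempty, isDirectedOrder_of_isFiltered B, hB⟩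

/-- The directed subsets of cardinality `< κ` of a partially ordered type. -/
abbrev SmallDirectedSubset (α : Type w) [PartialOrder α] (κ : Cardinal.{w}) :=
  { S : Set α // Nonempty S ∧ IsDirectedOrder S ∧ HasCardinalLT S κ }

namespace SmallDirectedSubset

variable {α : Type w} [PartialOrder α] {κ : Cardinal.{w}}

instance (S : SmallDirectedSubset α κ) : Nonempty S.1 := S.2.1
instance (S : SmallDirectedSubset α κ) : IsDirectedOrder S.1 := S.2.2.1

lemma isCardinalFiltered [IsDirectedOrder α] [Nonempty α] [Fact κ.IsRegular] (hκ : ℵ₀ < κ) :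
    IsCardinalFiltered (SmallDirectedSubset α κ) κ := by
  refine isCardinalFiltered_preorder _ _ fun K s hK ↦ ?_
  obtain ⟨B, hAB, h₁, h₂, h₃⟩ := HasCardinalLT.exists_directed_superset hκ (⋃ k, (s k).1)
    (hasCardinalLT_iUnion _ ((hasCardinalLT_iff_cardinal_mk_lt _ _).2 hK) fun k ↦ (s k).2.2.2)
  exact ⟨⟨B, h₁, h₂, h₃⟩, fun k ↦ (Set.subset_iUnion (fun k ↦ (s k).1) k).trans hAB⟩

lemma hasCardinalLT_arrow (hκ : ℵ₀ ≤ κ) (S : SmallDirectedSubset α κ) :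
    HasCardinalLT (Arrow S.1) κ := by
  refine (hasCardinalLT_prod hκ S.2.2.2 S.2.2.2).of_injective (fun f ↦ (f.left, f.right)) ?_
  rintro ⟨a, b, f⟩ ⟨a', b', f'⟩ h
  obtain ⟨rfl, rfl⟩ := Prod.ext_iff.1 h
  obtain rfl := Subsingleton.elim f f'
  rfl

/-- The subset with a single element. -/
def singleton (hκ : ℵ₀ ≤ κ) (a : α) : SmallDirectedSubset α κ :=
  ⟨{a}, inferInstance, ⟨fun x _ ↦ ⟨x, le_rfl, (Subsingleton.elim _ _).le⟩⟩,
    hasCardinalLT_of_finite _ _ hκ⟩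

variable {C : Type u} [Category.{v} C] [HasDirectedColimits.{w} C] (D : α ⥤ C)

/-- The restriction of a diagram to a directed subset. -/
abbrev restrict (S : SmallDirectedSubset α κ) : S.1 ⥤ C :=
  (Subtype.mono_coe (· ∈ S.1)).functor ⋙ D

instance (S : SmallDirectedSubset α κ) : HasColimit (restrict D S) :=
  have := HasDirectedColimits.hasColimitsOfShape (C := C) S.1
  inferInstance

/-- The cocone of the restricted diagram given by the colimit of a larger one. -/
noncomputable def restrictCocone {S T : SmallDirectedSubset α κ} (h : S ≤ T) :
    Cocone (restrict D S) where
  pt := colimit (restrict D T)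
  ι :=
    { app a := colimit.ι (restrict D T) ⟨a.1, h a.2⟩
      naturality a b g := (colimit.w (restrict D T)
        (show (⟨a.1, h a.2⟩ : T.1) ⟶ ⟨b.1, h b.2⟩ from homOfLE (leOfHom g))).trans
          (Category.comp_id _).symm }

variable (κ) in
/-- The functor sending a small directed subset to the colimit of the restricted diagram. -/
noncomputable def colimits : SmallDirectedSubset α κ ⥤ C where
  obj S := colimit (restrict D S)
  map f := colimit.desc _ (restrictCocone D (leOfHom f))
  map_id _ := colimit.hom_ext fun _ ↦ (colimit.ι_desc _ _).trans (Category.comp_id _).symm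
  map_comp f _ := colimit.hom_ext fun a ↦ (colimit.ι_desc _ _).trans <| Eq.symm <|
    ((reassoc_of% (colimit.ι_desc (restrictCocone D (leOfHom f)) a)) _).trans (colimit.ι_desc _ _)

/-- The inclusion of a directed subset in a colimit of a partial diagram. -/
noncomputable def ι (S : SmallDirectedSubset α κ) (a : α) (ha : a ∈ S.1) :
    D.obj a ⟶ (colimits κ D).obj S :=
  colimit.ι (restrict D S) ⟨a, ha⟩

variable {D} in
lemma hom_ext {S : SmallDirectedSubset α κ} {X : C} {f g : (colimits κ D).obj S ⟶ X}
    (h : ∀ a (ha : a ∈ S.1), ι D S a ha ≫ f = ι D S a ha ≫ g) : f = g :=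
  colimit.hom_ext fun a ↦ h a.1 a.2

lemma map_comp_ι (S : SmallDirectedSubset α κ) {a b : α} (f : a ⟶ b) (ha : a ∈ S.1)
    (hb : b ∈ S.1) : D.map f ≫ ι D S b hb = ι D S a ha :=
  colimit.w (restrict D S) (show (⟨a, ha⟩ : S.1) ⟶ ⟨b, hb⟩ from homOfLE (leOfHom f))

lemma ι_comp_colimits_map {S T : SmallDirectedSubset α κ} (f : S ⟶ T) (a : α) (ha : a ∈ S.1) :
    ι D S a ha ≫ (colimits κ D).map f = ι D T a (leOfHom f ha) :=
  colimit.ι_desc _ _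

variable {D} (c : Cocone D)

variable (κ) in
/-- The cocone exhibiting a colimit as a colimit of the colimits of the diagrams restricted to
small directed subsets. -/
noncomputable def cocone : Cocone (colimits κ D) where
  pt := c.pt
  ι :=
    { app S := colimit.desc (restrict D S) (c.whisker _)
      naturality _ _ f := colimit.hom_ext fun a ↦
        ((reassoc_of% (colimit.ι_desc (restrictCocone D (leOfHom f)) a)) _).trans <|
          (colimit.ι_desc _ _).trans <| Eq.symm <|
          (congr_arg _ (Category.comp_id _)).trans (colimit.ι_desc _ _) }

lemma ι_comp_cocone_ι_app (S : SmallDirectedSubset α κ) (a : α) (ha : a ∈ S.1) :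
    ι D S a ha ≫ (cocone κ c).ι.app S = c.ι.app a :=
  colimit.ι_desc _ _

lemma mem_singleton (hκ : ℵ₀ ≤ κ) (a : α) : a ∈ (singleton hκ a).1 := Set.mem_singleton a

lemma ι_comp_ι_app (hκ : ℵ₀ ≤ κ) (s : Cocone (colimits κ D)) (S : SmallDirectedSubset α κ)
    (a : α) (ha : a ∈ S.1) : ι D S a ha ≫ s.ι.app S =
      ι D (singleton hκ a) a (mem_singleton hκ a) ≫ s.ι.app (singleton hκ a) := by
  have : singleton hκ a ≤ S := Set.singleton_subset_iff.2 ha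
  rw [← s.w (homOfLE this), reassoc_of% ι_comp_colimits_map D (homOfLE this)]

/-- The cocone `SmallDirectedSubset.cocone` is colimiting. -/
noncomputable def isColimitCocone [IsDirectedOrder α] [Nonempty α] [Fact κ.IsRegular]
    (hκ : ℵ₀ < κ) (hc : IsColimit c) : IsColimit (cocone κ c) :=
  let t (s : Cocone (colimits κ D)) : Cocone D :=
    { pt := s.pt
      ι :=
        { app a := ι D (singleton hκ.le a) a (mem_singleton hκ.le a) ≫
            s.ι.app (singleton hκ.le a)
          naturality a b f := by
            -- The singletons of `a` and `b` need not be comparable, so the two legs are compared in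
            -- a small directed subset containing both points.
            obtain ⟨B, hAB, h₁, h₂, h₃⟩ := HasCardinalLT.exists_directed_superset hκ {a, b}
              (hasCardinalLT_of_finite _ _ hκ.le)
            have ha : a ∈ B := hAB (by simp)
            have hb : b ∈ B := hAB (by simp)
            rw [← ι_comp_ι_app hκ.le s ⟨B, h₁, h₂, h₃⟩ a ha,
              ← ι_comp_ι_app hκ.le s ⟨B, h₁, h₂, h₃⟩ b hb,
              reassoc_of% map_comp_ι D ⟨B, h₁, h₂, h₃⟩ f ha hb]
            simp } }
  { desc s := hc.desc (t s)
    fac s S := hom_ext fun a ha ↦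
      ((reassoc_of% (ι_comp_cocone_ι_app c S a ha)) _).trans <|
        (hc.fac (t s) a).trans (ι_comp_ι_app hκ.le s S a ha).symm
    uniq s m hm := hc.uniq (t s) m fun a ↦
      ((reassoc_of% (ι_comp_cocone_ι_app c _ a (mem_singleton hκ.le a))) m).symm.trans <|
        congr_arg (_ ≫ ·) (hm _) }

end SmallDirectedSubset

/-- After replacing `J` by a directed poset, the colimit is regrouped along the small directed
subsets; closure of `Q` handles each partial colimit. -/
lemma CategoryTheory.ObjectProperty.exists_colimitsOfShape_of_isFiltered
    {C : Type u} [Category.{v} C] [HasDirectedColimits.{w} C] {P Q : ObjectProperty C}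
    {κ : Cardinal.{w}} [Fact κ.IsRegular] (hκ : ℵ₀ < κ) (hPQ : P ≤ Q)
    (hQ : ∀ (J : Type w) [PartialOrder J] [IsDirectedOrder J] [Nonempty J],
      HasCardinalLT (Arrow J) κ → Q.IsClosedUnderColimitsOfShape J)
    (J : Type w) [SmallCategory J] [IsFiltered J] {X : C} (hX : P.colimitsOfShape J X) :
    ∃ (K : Type w) (_ : SmallCategory K) (_ : IsCardinalFiltered K κ),
      Q.colimitsOfShape K X := by
  obtain ⟨α, _, _, _, F, _⟩ := IsFiltered.exists_directed J
  obtain ⟨p⟩ := P.colimitsOfShape_le_of_final F _ hX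
  refine ⟨SmallDirectedSubset α κ, inferInstance, SmallDirectedSubset.isCardinalFiltered hκ,
    ⟨{  diag := SmallDirectedSubset.colimits κ p.diag
        ι := (SmallDirectedSubset.cocone κ p.cocone).ι
        isColimit := SmallDirectedSubset.isColimitCocone p.cocone hκ p.isColimit
        prop_diag_obj S := ?_ }⟩⟩
  have := hQ S.1 (SmallDirectedSubset.hasCardinalLT_arrow hκ.le S)
  exact Q.prop_colimit _ fun a ↦ hPQ _ (p.prop_diag_obj a.1)

end

/-! ### Raising the index of accessibility and preserving presentable objects -/

namespace CategoryTheory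

open Cardinal

variable {C : Type u₁} [Category.{v₁} C] {D : Type u₂} [Category.{v₂} D]
  [HasDirectedColimits.{w} C] {μ κ : Cardinal.{w}} [Fact μ.IsRegular] [Fact κ.IsRegular]

lemma ObjectProperty.IsCardinalFilteredGenerator.of_directed {P Q : ObjectProperty C}
    (hP : P.IsCardinalFilteredGenerator μ) (hκ : ℵ₀ < κ) (hPQ : P ≤ Q)
    (hQ : Q ≤ isCardinalPresentable C κ)
    (hQ' : ∀ (J : Type w) [PartialOrder J] [IsDirectedOrder J] [Nonempty J],
      HasCardinalLT (Arrow J) κ → Q.IsClosedUnderColimitsOfShape J) :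
    Q.IsCardinalFilteredGenerator κ where
  le_isCardinalPresentable := hQ
  exists_colimitsOfShape X := by
    obtain ⟨J, _, _, hX⟩ := hP.exists_colimitsOfShape X
    have := isFiltered_of_isCardinalFiltered J μ
    exact exists_colimitsOfShape_of_isFiltered hκ hPQ hQ' J hX

variable (C) in
-- The closure of a `μ`-generator under `κ`-small colimits is a `κ`-generator. Directed colimits let
-- `κ` be any uncountable regular cardinal above `μ`.
lemma IsCardinalAccessibleCategory.of_le [IsCardinalAccessibleCategory C μ] (hμ : μ ≤ κ)
    (hκ : ℵ₀ < κ) : IsCardinalAccessibleCategory C κ := by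
  obtain ⟨P, _, hP⟩ := HasCardinalFilteredGenerator.exists_generator C μ
  have := (hP.of_directed hκ (P.le_colimitsCardinalClosure κ)
    (P.colimitsCardinalClosure_le_isCardinalPresentable
      (hP.le_isCardinalPresentable.trans (isCardinalPresentable_monotone C hμ)))
    (fun J _ _ _ hJ ↦ P.isClosedUnderColimitsOfShape_colimitsCardinalClosure κ J
      hJ)).hasCardinalFilteredGenerator
  constructor

/-- The `κ`-presentable objects with `κ`-presentable image contain `P` and are closed under
`κ`-small directed colimits, so they form a `κ`-generator. Every `κ`-presentable object is a retract
of one of them, and `H` preserves retracts. -/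
lemma isCardinalPresentable_le_inverseImage_of_generator [LocallySmall.{w} C]
    [LocallySmall.{w} D] (H : C ⥤ D)
    [PreservesDirectedColimits.{w} H] {P : ObjectProperty C}
    (hP : P.IsCardinalFilteredGenerator μ) (hμ : μ ≤ κ) (hκ : ℵ₀ < κ)
    (hP' : P ≤ (isCardinalPresentable D κ).inverseImage H) :
    isCardinalPresentable C κ ≤ (isCardinalPresentable D κ).inverseImage H := by
  have hQ : (isCardinalPresentable C κ ⊓
      (isCardinalPresentable D κ).inverseImage H).IsCardinalFilteredGenerator κ := by
    refine hP.of_directed hκ (le_inf (hP.le_isCardinalPresentable.trans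
      (isCardinalPresentable_monotone C hμ)) hP') inf_le_left fun J _ _ _ hJ ↦ ?_
    have := PreservesDirectedColimits.preservesColimitsOfShape (F := H) J
    have := isClosedUnderColimitsOfShape_isCardinalPresentable C hJ
    have := isClosedUnderColimitsOfShape_isCardinalPresentable D hJ
    exact ⟨fun X ⟨p⟩ ↦ ⟨(p.ofLE inf_le_left).prop, (p.ofLE inf_le_right).prop⟩⟩
  rw [hQ.isPresentable_eq_retractClosure]
  rintro X ⟨Y, hY, ⟨r⟩⟩
  exact (isCardinalPresentable D κ).prop_of_retract (r.map H) hY.2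

lemma exists_cardinal_forall_isCardinalPresentable_le_inverseImage
    [IsAccessibleCategory.{w} C] [IsAccessibleCategory.{w} D] (H : C ⥤ D)
    [PreservesDirectedColimits.{w} H] :
    ∃ (κ₀ : Cardinal.{w}), ∀ (κ : Cardinal.{w}) [Fact κ.IsRegular], κ₀ ≤ κ → ℵ₀ < κ →
      IsCardinalAccessibleCategory C κ ∧
        isCardinalPresentable C κ ≤ (isCardinalPresentable D κ).inverseImage H := by
  obtain ⟨μ, _, _⟩ := IsAccessibleCategory.exists_cardinal C
  obtain ⟨ν, _, _⟩ := IsAccessibleCategory.exists_cardinal D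
  obtain ⟨P, _, hP⟩ := HasCardinalFilteredGenerator.exists_small_generator C μ
  -- Each object of the accessible category `D` is presentable for some cardinal; smallness of the
  -- generator allows a common bound.
  choose l hl hl' using fun (X : Subtype P) ↦
    Functor.IsAccessible.exists_cardinal.{w} (F := coyoneda.obj (.op (H.obj X.1)))
  obtain ⟨κ₁, _, hκ₁⟩ := HasCardinalLT.exists_regular_cardinal_forall.{w}
    (fun X : Shrink.{w} (Subtype P) ↦ (l ((equivShrink _).symm X)).ord.ToType)
  refine ⟨μ ⊔ κ₁, fun κ _ h₀ hκ ↦ ⟨.of_le C (le_sup_left.trans h₀) hκ,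
    isCardinalPresentable_le_inverseImage_of_generator H hP (le_sup_left.trans h₀) hκ
      fun X hX ↦ ?_⟩⟩
  have hX' : l ⟨X, hX⟩ ≤ κ := by
    have := hκ₁ (equivShrink _ ⟨X, hX⟩)
    rw [Equiv.symm_apply_apply, hasCardinalLT_iff_cardinal_mk_lt, mk_ord_toType] at this
    exact this.le.trans (le_sup_right.trans h₀)
  have : IsCardinalPresentable (H.obj X) (l ⟨X, hX⟩) := hl' ⟨X, hX⟩
  exact isCardinalPresentable_of_le (H.obj X) hX'

end CategoryTheory

/-! ### A criterion for accessibility from two jointly faithful functors -/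

namespace CategoryTheory

open Cardinal

section

variable {Q : Type u} [Category.{v} Q] {E : Type u₁} [Category.{v₁} E] (T : Q ⥤ E)
  {W : ObjectProperty Q} {P : ObjectProperty E} (h : W ≤ P.inverseImage T)

/-- The costructured arrow to `x` given by a morphism from an object satisfying `P`. -/
abbrev ObjectProperty.costructuredArrowMk (P : ObjectProperty E) {x p : E} (hp : P p)
    (m : p ⟶ x) : CostructuredArrow P.ι x :=
  CostructuredArrow.mk (Y := ⟨p, hp⟩) (by exact m)

/-- Constructor for morphisms in the category of objects satisfying `P` over `x`. -/
abbrev ObjectProperty.costructuredArrowHomMk {P : ObjectProperty E} {x : E}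
    {f g : CostructuredArrow P.ι x} (φ : f.left.obj ⟶ g.left.obj)
    (hφ : φ ≫ (show g.left.obj ⟶ x from g.hom) = f.hom) : f ⟶ g :=
  CostructuredArrow.homMk (ObjectProperty.homMk φ) hφ

lemma ObjectProperty.costructuredArrow_hom_ext {P : ObjectProperty E} {x : E}
    {f g : CostructuredArrow P.ι x} {φ ψ : f ⟶ g} (h : φ.left.hom = ψ.left.hom) : φ = ψ := by
  ext
  exact h

/-- The functor between categories of costructured arrows induced by a functor sending objects
satisfying `W` to objects satisfying `P`. -/
def ObjectProperty.costructuredArrowMap (x : Q) :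
    CostructuredArrow W.ι x ⥤ CostructuredArrow P.ι (T.obj x) where
  obj f := P.costructuredArrowMk (h _ f.left.property) (T.map f.hom)
  map φ := costructuredArrowHomMk (T.map φ.left.hom)
    ((T.map_comp _ _).symm.trans (T.congr_map (CostructuredArrow.w φ)))
  map_id _ := costructuredArrow_hom_ext (T.map_id _)
  map_comp _ _ := costructuredArrow_hom_ext (T.map_comp _ _)

/-- The canonical cocone with point `x` over the objects over `x` which satisfy a property. -/
abbrev ObjectProperty.canonicalCocone (W : ObjectProperty Q) (x : Q) :
    Cocone (CostructuredArrow.proj W.ι x ⋙ W.ι) :=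
  (Functor.LeftExtension.mk _ W.ι.rightUnitor.inv).coconeAt x

lemma ObjectProperty.nonempty_isColimit_mapCocone_canonicalCocone [P.ι.IsDense] (x : Q)
    [(costructuredArrowMap T h x).Final] :
    Nonempty (IsColimit (T.mapCocone (W.canonicalCocone x))) := by
  have := (Functor.Final.isColimitWhiskerEquiv (costructuredArrowMap T h x) _).symm
    (P.ι.denseAt (T.obj x))
  let c : Cocone ((CostructuredArrow.proj W.ι x ⋙ W.ι) ⋙ T) :=
    ⟨T.obj x, ((P.canonicalCocone (T.obj x)).whisker (costructuredArrowMap T h x)).ι⟩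
  exact ⟨IsColimit.ofIsoColimit (show IsColimit c from this) (Cocone.ext (Iso.refl _) fun j ↦
    (Category.comp_id _).trans ((Category.id_comp _).trans (T.congr_map (Category.id_comp _).symm)))⟩

end

variable {Q : Type u} [Category.{v} Q] {E : Type u₁} [Category.{v₁} E]
  {E' : Type u₂} [Category.{v₂} E']

/-- The condition that for a `κ`-small family of morphisms to `x` from objects satisfying `W`,
any pair of factorizations of its images under `T` and `S` through `κ`-presentable objects
can be refined to a factorization of the family through an object satisfying `W`. -/
structure JointlyRefines (T : Q ⥤ E) (S : Q ⥤ E') (W : ObjectProperty Q) (κ : Cardinal.{w})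
    [Fact κ.IsRegular] : Prop where
  exists_refinement {J : Type w} (_ : HasCardinalLT J κ) {K : J → Q} (_ : ∀ j, W (K j)) {x : Q}
    (f : ∀ j, K j ⟶ x) {e : E} (_ : IsCardinalPresentable e κ) {e' : E'}
    (_ : IsCardinalPresentable e' κ) (d : ∀ j, T.obj (K j) ⟶ e) (d' : ∀ j, S.obj (K j) ⟶ e')
    (u : e ⟶ T.obj x) (_ : ∀ j, d j ≫ u = T.map (f j))
    (u' : e' ⟶ S.obj x) (_ : ∀ j, d' j ≫ u' = S.map (f j)) :
    ∃ (p : Q) (_ : W p) (q : ∀ j, K j ⟶ p) (m : p ⟶ x) (a : e ⟶ T.obj p)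
      (a' : e' ⟶ S.obj p), (∀ j, T.map (q j) = d j ≫ a) ∧
      (∀ j, S.map (q j) = d' j ≫ a') ∧ a ≫ T.map m = u ∧ a' ≫ S.map m = u'

namespace JointlyRefines

variable {T : Q ⥤ E} {S : Q ⥤ E'} {W : ObjectProperty Q} {κ : Cardinal.{w}}
    [Fact κ.IsRegular] (H : JointlyRefines T S W κ)

include H in
lemma symm : JointlyRefines S T W κ where
  exists_refinement hJ _ hK _ f _ he _ he' d d' u hu u' hu' := by
    obtain ⟨p, hp, q, m, a, a', h₁, h₂, h₃, h₄⟩ :=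
      H.exists_refinement hJ hK f he' he d' d u' hu' u hu
    exact ⟨p, hp, q, m, a', a, h₂, h₁, h₄, h₃⟩

variable (hT : W ≤ (isCardinalPresentable E κ).inverseImage T)
  (hS : W ≤ (isCardinalPresentable E' κ).inverseImage S)
  (hTS : ∀ {x y : Q} (f g : x ⟶ y), T.map f = T.map g → S.map f = S.map g → f = g)

include H hTS in
-- The triangles over `x` follow from joint faithfulness, so the refinement condition need not
-- include them.
lemma exists_factorization {J : Type w} (hJ : HasCardinalLT J κ) {K : J → Q} (hK : ∀ j, W (K j))
    {x : Q} (f : ∀ j, K j ⟶ x) {e : E} (he : IsCardinalPresentable e κ) {e' : E'}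
    (he' : IsCardinalPresentable e' κ) (d : ∀ j, T.obj (K j) ⟶ e) (d' : ∀ j, S.obj (K j) ⟶ e')
    (u : e ⟶ T.obj x) (hu : ∀ j, d j ≫ u = T.map (f j))
    (u' : e' ⟶ S.obj x) (hu' : ∀ j, d' j ≫ u' = S.map (f j)) :
    ∃ (p : Q) (_ : W p) (q : ∀ j, K j ⟶ p) (m : p ⟶ x) (a : e ⟶ T.obj p)
      (a' : e' ⟶ S.obj p), (∀ j, q j ≫ m = f j) ∧ (∀ j, T.map (q j) = d j ≫ a) ∧
      (∀ j, S.map (q j) = d' j ≫ a') ∧ a ≫ T.map m = u ∧ a' ≫ S.map m = u' := by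
  obtain ⟨p, hp, q, m, a, a', h₁, h₂, h₃, h₄⟩ :=
    H.exists_refinement hJ hK f he he' d d' u hu u' hu'
  exact ⟨p, hp, q, m, a, a', fun j ↦ hTS _ _ (by simp [h₁, h₃, hu]) (by simp [h₂, h₄, hu']),
    h₁, h₂, h₃, h₄⟩

include H hTS in
lemma exists_costructuredArrow {J : Type w} (hJ : HasCardinalLT J κ) {x : Q}
    (F : J → CostructuredArrow W.ι x)
    (c : CostructuredArrow (isCardinalPresentable E κ).ι (T.obj x))
    (c' : CostructuredArrow (isCardinalPresentable E' κ).ι (S.obj x))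
    (d : ∀ j, (ObjectProperty.costructuredArrowMap T hT x).obj (F j) ⟶ c)
    (d' : ∀ j, (ObjectProperty.costructuredArrowMap S hS x).obj (F j) ⟶ c') :
    ∃ (p : CostructuredArrow W.ι x) (q : ∀ j, F j ⟶ p)
      (a : c ⟶ (ObjectProperty.costructuredArrowMap T hT x).obj p)
      (a' : c' ⟶ (ObjectProperty.costructuredArrowMap S hS x).obj p),
      (∀ j, (ObjectProperty.costructuredArrowMap T hT x).map (q j) = d j ≫ a) ∧
      (∀ j, (ObjectProperty.costructuredArrowMap S hS x).map (q j) = d' j ≫ a') := by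
  obtain ⟨p, hp, q, m, a, a', hq, h₁, h₂, h₃, h₄⟩ := H.exists_factorization hTS hJ
    (fun j ↦ (F j).left.property) (fun j ↦ (F j).hom) c.left.property c'.left.property
    (fun j ↦ (d j).left.hom) (fun j ↦ (d' j).left.hom)
    c.hom (fun j ↦ CostructuredArrow.w (d j)) c'.hom (fun j ↦ CostructuredArrow.w (d' j))
  exact ⟨W.costructuredArrowMk hp m, fun j ↦ ObjectProperty.costructuredArrowHomMk (q j) (hq j),
    ObjectProperty.costructuredArrowHomMk a h₃, ObjectProperty.costructuredArrowHomMk a' h₄,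
    fun j ↦ ObjectProperty.costructuredArrow_hom_ext (h₁ j),
    fun j ↦ ObjectProperty.costructuredArrow_hom_ext (h₂ j)⟩

include hTS in
lemma costructuredArrow_hom_ext {x : Q} {f g : CostructuredArrow W.ι x} {φ ψ : f ⟶ g}
    (h₁ : (ObjectProperty.costructuredArrowMap T hT x).map φ =
      (ObjectProperty.costructuredArrowMap T hT x).map ψ)
    (h₂ : (ObjectProperty.costructuredArrowMap S hS x).map φ =
      (ObjectProperty.costructuredArrowMap S hS x).map ψ) : φ = ψ :=
  ObjectProperty.costructuredArrow_hom_ext (hTS _ _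
    (congr_arg (fun α ↦ α.left.hom) h₁) (congr_arg (fun α ↦ α.left.hom) h₂))

variable [IsCardinalAccessibleCategory E κ] [IsCardinalAccessibleCategory E' κ]

include H hT hS hTS in
-- Cocones on the two image diagrams exist by accessibility of `E` and `E'`. Refining both gives the
-- legs of a cocone, whose naturality is tested after `T` and `S`.
lemma isCardinalFiltered (x : Q) : IsCardinalFiltered (CostructuredArrow W.ι x) κ where
  nonempty_cocone {J _} F hJ := by
    let cT := IsCardinalFiltered.cocone (F ⋙ ObjectProperty.costructuredArrowMap T hT x) hJ
    let cS := IsCardinalFiltered.cocone (F ⋙ ObjectProperty.costructuredArrowMap S hS x) hJ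
    obtain ⟨p, q, a, a', h₁, h₂⟩ := H.exists_costructuredArrow hT hS hTS
      (hasCardinalLT_of_hasCardinalLT_arrow hJ) F.obj cT.pt cS.pt cT.ι.app cS.ι.app
    exact ⟨{
      pt := p
      ι := { app := q
             naturality i j f := by
              refine costructuredArrow_hom_ext hT hS hTS ?_ ?_
              · have := cT.w f
                dsimp at this
                simp [h₁, reassoc_of% this]
              · have := cS.w f
                dsimp at this
                simp [h₂, reassoc_of% this] } }⟩

include H hT hS hTS in
lemma final_costructuredArrowMap (x : Q) :
    (ObjectProperty.costructuredArrowMap T hT x).Final := by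
  have := H.isCardinalFiltered hT hS hTS x
  have := isFiltered_of_isCardinalFiltered (CostructuredArrow W.ι x) κ
  have := isFiltered_of_isCardinalFiltered
    (CostructuredArrow (isCardinalPresentable E κ).ι (T.obj x)) κ
  have hκ : ℵ₀ ≤ κ := IsRegular.aleph0_le Fact.out
  refine Functor.final_of_exists_of_isFiltered _ (fun d ↦ ?_) fun {d f} s s' ↦ ?_
  -- The empty family gives an object receiving a map from `d`; on the other side any
  -- `κ`-presentable object over `S.obj x` serves.
  · obtain ⟨d'⟩ := IsCardinalFiltered.nonempty
      (CostructuredArrow (isCardinalPresentable E' κ).ι (S.obj x)) κ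
    obtain ⟨p, _, a, _⟩ := H.exists_costructuredArrow hT hS hTS (J := PEmpty)
      (hasCardinalLT_of_finite _ _ hκ) (by rintro ⟨⟩) d d' (by rintro ⟨⟩) (by rintro ⟨⟩)
    exact ⟨p, ⟨a⟩⟩
  -- The one-element family is refined through the coequalizer of `s` and `s'` on the `T` side and
  -- through the identity on the `S` side.
  · obtain ⟨p, q, a, _, h₁, _⟩ := H.exists_costructuredArrow hT hS hTS (J := PUnit)
      (hasCardinalLT_of_finite _ _ hκ) (fun _ ↦ f) _ _
      (fun _ ↦ IsFiltered.coeqHom s s') (fun _ ↦ 𝟙 _)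
    exact ⟨p, q ⟨⟩, by rw [h₁, reassoc_of% IsFiltered.coeq_condition s s']⟩

include H hT hS hTS in
-- By finality, `T` and `S` send canonical cocones to colimits, so `hrefl` makes `W` dense; its
-- canonical diagrams are `κ`-filtered.
lemma isCardinalAccessibleCategory [LocallySmall.{w} Q] [HasCardinalFilteredColimits Q κ]
    [ObjectProperty.EssentiallySmall.{w} W] (hW : W ≤ isCardinalPresentable Q κ)
    (hrefl : ∀ {J : Type (max u v)} [Category.{v} J] [EssentiallySmall.{w} J]
      [IsCardinalFiltered J κ] {K : J ⥤ Q} (c : Cocone K), IsColimit (T.mapCocone c) →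
      IsColimit (S.mapCocone c) → Nonempty (IsColimit c)) :
    IsCardinalAccessibleCategory Q κ := by
  have := H.isCardinalFiltered hT hS hTS
  have : W.ι.IsDense := ⟨fun x ↦ by
    have := H.final_costructuredArrowMap hT hS hTS x
    have := H.symm.final_costructuredArrowMap hS hT (fun f g h₁ h₂ ↦ hTS f g h₂ h₁) x
    obtain ⟨h₁⟩ := ObjectProperty.nonempty_isColimit_mapCocone_canonicalCocone T hT x
    obtain ⟨h₂⟩ := ObjectProperty.nonempty_isColimit_mapCocone_canonicalCocone S hS x
    exact hrefl _ h₁ h₂⟩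
  have := (IsCardinalFilteredGenerator.of_isDense_ι W κ hW).hasCardinalFilteredGenerator
  constructor

end JointlyRefines

end CategoryTheory

/-! ### Accessibility of arrow categories -/

namespace CategoryTheory

open Cardinal

section

variable {C : Type u} [Category.{v} C]

lemma IsCardinalPresentable.mk_of_exists {X : C} {κ : Cardinal.{w}} [Fact κ.IsRegular]
    (h₁ : ∀ {J : Type w} [SmallCategory J] [IsCardinalFiltered J κ] {K : J ⥤ C} {c : Cocone K}
      (_ : IsColimit c) (f : X ⟶ c.pt), ∃ (j : J) (g : X ⟶ K.obj j), g ≫ c.ι.app j = f)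
    (h₂ : ∀ {J : Type w} [SmallCategory J] [IsCardinalFiltered J κ] {K : J ⥤ C} {c : Cocone K}
      (_ : IsColimit c) {j : J} (f g : X ⟶ K.obj j), f ≫ c.ι.app j = g ≫ c.ι.app j →
        ∃ (k : J) (φ : j ⟶ k), f ≫ K.map φ = g ≫ K.map φ) :
    IsCardinalPresentable X κ where
  preservesColimitOfShape J _ _ :=
    ⟨fun {K} ↦ ⟨fun {c} hc ↦ by
      have := isFiltered_of_isCardinalFiltered J κ
      refine ⟨Types.FilteredColimit.isColimitOf' _ _ (fun f ↦ ?_) (fun j f g h ↦ h₂ hc f g h)⟩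
      obtain ⟨j, g, hg⟩ := h₁ hc f
      exact ⟨j, g, hg.symm⟩⟩⟩

variable (C) in
/-- The arrows with `κ`-presentable source and target. -/
abbrev isCardinalPresentableLeftRight (κ : Cardinal.{w}) [Fact κ.IsRegular] :
    ObjectProperty (Arrow C) :=
  (isCardinalPresentable C κ).inverseImage Arrow.leftFunc ⊓
    (isCardinalPresentable C κ).inverseImage Arrow.rightFunc

instance essentiallySmall_isCardinalPresentableLeftRight (κ : Cardinal.{w}) [Fact κ.IsRegular]
    [HasCardinalFilteredGenerator C κ] :
    ObjectProperty.EssentiallySmall.{w} (isCardinalPresentableLeftRight C κ) := by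
  obtain ⟨Q, _, hQ⟩ :=
    ObjectProperty.EssentiallySmall.exists_small_le' (isCardinalPresentable C κ)
  refine ⟨.ofObj (fun t : Σ (a b : Subtype Q), (a.1 ⟶ b.1) ↦ Arrow.mk t.2.2),
    inferInstance, fun f hf ↦ ?_⟩
  obtain ⟨a, ha, ⟨e₁⟩⟩ := hQ _ hf.1
  obtain ⟨b, hb, ⟨e₂⟩⟩ := hQ _ hf.2
  have e₁ : f.left ≅ a := e₁
  have e₂ : f.right ≅ b := e₂
  exact ⟨Arrow.mk (e₁.inv ≫ f.hom ≫ e₂.hom),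
    ObjectProperty.ofObj_apply
      (fun t : Σ (a b : Subtype Q), (a.1 ⟶ b.1) ↦ Arrow.mk t.2.2)
      ⟨⟨a, ha⟩, ⟨b, hb⟩, e₁.inv ≫ f.hom ≫ e₂.hom⟩,
    ⟨Arrow.isoMk e₁ e₂ (by simp)⟩⟩

/-- The components of a morphism to a colimit factor through stages. The resulting square commutes
in the colimit, hence at a later stage because `p.left` is presentable. -/
lemma isCardinalPresentableLeftRight_le {κ : Cardinal.{w}} [Fact κ.IsRegular]
    [HasCardinalFilteredColimits C κ] :
    isCardinalPresentableLeftRight C κ ≤ isCardinalPresentable (Arrow C) κ := by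
  rintro p ⟨h₁, h₂⟩
  have h₁ : IsCardinalPresentable p.left κ := h₁
  have h₂ : IsCardinalPresentable p.right κ := h₂
  refine IsCardinalPresentable.mk_of_exists (fun {J _ _ K c} hc f ↦ ?_)
    fun {J _ _ K c} hc j f g hfg ↦ ?_
  · have := isFiltered_of_isCardinalFiltered J κ
    have := HasCardinalFilteredColimits.hasColimitsOfShape C (κ := κ) J
    have hl := isColimitOfPreserves Arrow.leftFunc hc
    have hr := isColimitOfPreserves Arrow.rightFunc hc
    obtain ⟨j₁, (g₁ : p.left ⟶ (K.obj j₁).left), (hg₁ : g₁ ≫ (c.ι.app j₁).left = f.left)⟩ :=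
      IsCardinalPresentable.exists_hom_of_isColimit κ hl f.left
    obtain ⟨j₂, (g₂ : p.right ⟶ (K.obj j₂).right),
      (hg₂ : g₂ ≫ (c.ι.app j₂).right = f.right)⟩ :=
      IsCardinalPresentable.exists_hom_of_isColimit κ hr f.right
    have hg : (g₁ ≫ (K.obj j₁).hom) ≫ (c.ι.app j₁).right =
        (p.hom ≫ g₂) ≫ (c.ι.app j₂).right := by
      simp [← Arrow.w, reassoc_of% hg₁, hg₂]
    obtain ⟨k, a, b, (hab : (g₁ ≫ (K.obj j₁).hom) ≫ (K.map a).right =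
      (p.hom ≫ g₂) ≫ (K.map b).right)⟩ := IsCardinalPresentable.exists_eq_of_isColimit κ hr
        (g₁ ≫ (K.obj j₁).hom) (p.hom ≫ g₂) hg
    refine ⟨k, Arrow.homMk (g₁ ≫ (K.map a).left) (g₂ ≫ (K.map b).right)
      (by simpa using hab), Arrow.hom_ext _ _ ?_ ?_⟩
    · have := congr_arg Arrow.Hom.left (c.w a)
      simp only [Arrow.comp_left] at this
      simp [this, hg₁]
    · have := congr_arg Arrow.Hom.right (c.w b)
      simp only [Arrow.comp_right] at this
      simp [this, hg₂]
  · have := isFiltered_of_isCardinalFiltered J κ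
    have := HasCardinalFilteredColimits.hasColimitsOfShape C (κ := κ) J
    obtain ⟨k₁, a₁, (h₁ : f.left ≫ (K.map a₁).left = g.left ≫ (K.map a₁).left)⟩ :=
      IsCardinalPresentable.exists_eq_of_isColimit' κ
        (isColimitOfPreserves Arrow.leftFunc hc) f.left g.left (congr_arg CommaMorphism.left hfg)
    obtain ⟨k₂, a₂, (h₂ : f.right ≫ (K.map a₂).right = g.right ≫ (K.map a₂).right)⟩ :=
      IsCardinalPresentable.exists_eq_of_isColimit' κ
        (isColimitOfPreserves Arrow.rightFunc hc) f.right g.right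
        (congr_arg CommaMorphism.right hfg)
    obtain ⟨k, b₁, b₂, h⟩ := IsFiltered.span a₁ a₂
    refine ⟨k, a₁ ≫ b₁, Arrow.hom_ext _ _ ?_ ?_⟩
    · simp [reassoc_of% h₁]
    · simp [h, reassoc_of% h₂]

/-- The source `e` is kept, and `e'` is enlarged to a `κ`-presentable object over `x.right` that
also receives `e`. -/
lemma arrow_jointlyRefines (κ : Cardinal.{w}) [Fact κ.IsRegular]
    [IsCardinalAccessibleCategory C κ] :
    JointlyRefines (Arrow.leftFunc (C := C)) Arrow.rightFunc
      (isCardinalPresentableLeftRight C κ) κ where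
  exists_refinement {J hJ K hK x} f {e} he {e'} he' d d' u hu u' hu' := by
    change ∀ j, (K j).left ⟶ e at d
    change ∀ j, (K j).right ⟶ e' at d'
    change e ⟶ x.left at u
    change e' ⟶ x.right at u'
    change ∀ j, d j ≫ u = (f j).left at hu
    change ∀ j, d' j ≫ u' = (f j).right at hu'
    let P := isCardinalPresentable C κ
    let R := CostructuredArrow P.ι x.right
    have := isFiltered_of_isCardinalFiltered R κ
    let r₀ : R := P.costructuredArrowMk he (u ≫ x.hom)
    let r₁ : R := P.costructuredArrowMk he' u'
    let s (j : J) : R := P.costructuredArrowMk (hK j).1 ((f j).left ≫ x.hom)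
    let α (j : J) : s j ⟶ r₀ := ObjectProperty.costructuredArrowHomMk (d j) (by
      have : d j ≫ u ≫ x.hom = (f j).left ≫ x.hom := by rw [reassoc_of% hu]
      exact this)
    let β (j : J) : s j ⟶ r₁ := ObjectProperty.costructuredArrowHomMk ((K j).hom ≫ d' j) (by
      have : ((K j).hom ≫ d' j) ≫ u' = (f j).left ≫ x.hom := by simp [hu']
      exact this)
    -- Coequalizing the `κ`-small family of pairs makes the squares from all `K j` commute at once.
    obtain ⟨r, a, h⟩ := IsCardinalFiltered.multicoequalizer
      (fun j ↦ α j ≫ IsFiltered.leftToMax r₀ r₁) (fun j ↦ β j ≫ IsFiltered.rightToMax r₀ r₁) hJ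
    let a₀ : r₀ ⟶ r := IsFiltered.leftToMax r₀ r₁ ≫ a
    let a₁ : r₁ ⟶ r := IsFiltered.rightToMax r₀ r₁ ≫ a
    let b₀ : e ⟶ r.left.obj := a₀.left.hom
    let b₁ : e' ⟶ r.left.obj := a₁.left.hom
    have hb (j) : d j ≫ b₀ = (K j).hom ≫ d' j ≫ b₁ := by
      have h : α j ≫ a₀ = β j ≫ a₁ := by simpa [a₀, a₁] using h j
      exact (congr_arg (fun φ ↦ φ.left.hom) h).trans (Category.assoc _ _ _)
    have hb₀ : b₀ ≫ (show r.left.obj ⟶ x.right from r.hom) = u ≫ x.hom := CostructuredArrow.w a₀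
    have hb₁ : b₁ ≫ (show r.left.obj ⟶ x.right from r.hom) = u' := CostructuredArrow.w a₁
    exact ⟨Arrow.mk b₀, ⟨he, r.left.property⟩, fun j ↦ Arrow.homMk (d j) (d' j ≫ b₁) (hb j),
      Arrow.homMk u (show r.left.obj ⟶ x.right from r.hom) hb₀.symm, 𝟙 _, b₁,
      fun j ↦ (Category.comp_id _).symm, fun j ↦ rfl, Category.id_comp _, hb₁⟩

instance isCardinalAccessibleCategory_arrow (κ : Cardinal.{w}) [Fact κ.IsRegular]
    [IsCardinalAccessibleCategory C κ] :
    IsCardinalAccessibleCategory (Arrow C) κ := by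
  have : HasCardinalFilteredColimits (Arrow C) κ := ⟨fun J _ _ ↦
    have := HasCardinalFilteredColimits.hasColimitsOfShape C (κ := κ) J
    inferInstance⟩
  have : LocallySmall.{w} (Arrow C) := inferInstanceAs (LocallySmall.{w} (Comma _ _))
  exact (arrow_jointlyRefines κ).isCardinalAccessibleCategory inf_le_left inf_le_right
    (fun f g h₁ h₂ ↦ Arrow.hom_ext _ _ h₁ h₂) isCardinalPresentableLeftRight_le
    fun c h₁ h₂ ↦ ⟨Arrow.isColimitOfLeftRight h₁ h₂⟩

instance [IsAccessibleCategory.{w} C] : IsAccessibleCategory.{w} (Arrow C) where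
  exists_cardinal := by
    obtain ⟨κ, _, _⟩ := IsAccessibleCategory.exists_cardinal C
    exact ⟨κ, inferInstance, inferInstance⟩

end

end CategoryTheory

/-! ### Back-and-forth between two presentations of an object -/

namespace CategoryTheory

open Cardinal

section

variable {B : Type u} [Category.{v} B]

/-- Each equation holds at some stage; there are fewer than `κ` of them, so one stage serves for
all. -/
lemma IsCardinalPresentable.exists_hom_of_isColimit_of_family {κ : Cardinal.{w}}
    [Fact κ.IsRegular] {J : Type u₁} [Category.{v₁} J] [EssentiallySmall.{w} J]
    [IsCardinalFiltered J κ] {F : J ⥤ B} {c : Cocone F} (hc : IsColimit c) {x : B}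
    (hx : IsCardinalPresentable x κ) (p : x ⟶ c.pt) {ι : Type w} (hι : HasCardinalLT ι κ)
    {V : ι → B} (hV : ∀ i, IsCardinalPresentable (V i) κ) {k : J} (a : ∀ i, V i ⟶ x)
    (b : ∀ i, V i ⟶ F.obj k) (hab : ∀ i, a i ≫ p = b i ≫ c.ι.app k) :
    ∃ (k' : J) (g : k ⟶ k') (α : x ⟶ F.obj k'), α ≫ c.ι.app k' = p ∧
      ∀ i, a i ≫ α = b i ≫ F.map g := by
  have := isFiltered_of_isCardinalFiltered J κ
  obtain ⟨k₁, α₁, h₁⟩ := exists_hom_of_isColimit κ hc p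
  let r := IsFiltered.leftToMax k k₁
  let s := IsFiltered.rightToMax k k₁
  have (i : ι) : ∃ (l : J) (t : IsFiltered.max k k₁ ⟶ l),
      (a i ≫ α₁ ≫ F.map s) ≫ F.map t = (b i ≫ F.map r) ≫ F.map t :=
    exists_eq_of_isColimit' κ hc _ _ (by simp [h₁, hab])
  choose l t ht using this
  obtain ⟨k', y, t', h⟩ := IsCardinalFiltered.wideSpan t hι
  refine ⟨k', r ≫ t', α₁ ≫ F.map s ≫ F.map t', by simp [h₁], fun i ↦ ?_⟩
  have := ht i =≫ F.map (y i)
  simp only [Category.assoc, ← Functor.map_comp, h i] at this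
  simpa using this

/-- Interleaved sequences have isomorphic colimits. -/
lemma exists_iso_of_interleaving {M N : ℕ ⥤ B} (α : M ⟶ N)
    (β : ∀ n, N.obj n ⟶ M.obj (n + 1))
    (hαβ : ∀ n, α.app n ≫ β n = M.map (homOfLE (Nat.le_add_right n 1)))
    (hβα : ∀ n, β n ≫ α.app (n + 1) = N.map (homOfLE (Nat.le_add_right n 1)))
    {cM : Cocone M} (hM : IsColimit cM) {cN : Cocone N} (hN : IsColimit cN) :
    ∃ (φ : cM.pt ≅ cN.pt), ∀ n, cM.ι.app n ≫ φ.hom = α.app n ≫ cN.ι.app n := by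
  let r : cM.pt ⟶ cN.pt := hM.desc ((Cocone.precompose α).obj cN)
  have hr (n : ℕ) : cM.ι.app n ≫ r = α.app n ≫ cN.ι.app n :=
    hM.fac ((Cocone.precompose α).obj cN) n
  let c : Cocone N :=
    { pt := cM.pt
      ι := NatTrans.ofSequence (fun n ↦ β n ≫ cM.ι.app (n + 1)) (fun n ↦ by
        rw [← hβα, Category.assoc, reassoc_of% (hαβ (n + 1)), cM.w]
        exact (Category.comp_id _).symm) }
  have hs (n : ℕ) : cN.ι.app n ≫ hN.desc c = β n ≫ cM.ι.app (n + 1) := hN.fac c n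
  refine ⟨⟨r, hN.desc c, hM.hom_ext fun n ↦ ?_, hN.hom_ext fun n ↦ ?_⟩, hr⟩
  · rw [reassoc_of% (hr n), hs, reassoc_of% (hαβ n), cM.w]
    exact (Category.comp_id _).symm
  · rw [reassoc_of% (hs n), hr, reassoc_of% (hβα n), cN.w]
    exact (Category.comp_id _).symm

section

variable {J : Type u₁} [Category.{v₁} J] {K : Type u₂} [Category.{v₂} K]
  {X : J ⥤ B} {Y : K ⥤ B}

/-- A comparison between objects of two diagrams which is compatible with a morphism between
the points of two cocones. -/
structure CoconeLink (cX : Cocone X) (cY : Cocone Y) (θ : cX.pt ⟶ cY.pt) where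
  /-- the index of the source -/
  source : J
  /-- the index of the target -/
  target : K
  /-- the comparison morphism -/
  hom : X.obj source ⟶ Y.obj target
  w : hom ≫ cY.ι.app target = cX.ι.app source ≫ θ

variable {cX : Cocone X} {cY : Cocone Y} {θ : cX.pt ≅ cY.pt}

namespace CoconeLink

variable {κ : Cardinal.{w}} [Fact κ.IsRegular]
  [EssentiallySmall.{w} J] [EssentiallySmall.{w} K]
  [IsCardinalFiltered J κ] [IsCardinalFiltered K κ]
  (hcX : IsColimit cX) (hcY : IsColimit cY)
  (hX : ∀ j, IsCardinalPresentable (X.obj j) κ) (hY : ∀ k, IsCardinalPresentable (Y.obj k) κ)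

include hcX hcY hX hY

/-- One step back through `θ.inv` and one forth through `θ.hom`; the one-element families force the
two triangles to commute at finite stages. -/
lemma exists_next (L : CoconeLink cX cY θ.hom) :
    ∃ (L' : CoconeLink cX cY θ.hom) (f : L.source ⟶ L'.source) (g : L.target ⟶ L'.target)
      (β : Y.obj L.target ⟶ X.obj L'.source),
      L.hom ≫ β = X.map f ∧ β ≫ L'.hom = Y.map g := by
  have hκ : ℵ₀ ≤ κ := IsRegular.aleph0_le Fact.out
  have hι : HasCardinalLT PUnit.{w + 1} κ := hasCardinalLT_of_finite _ _ hκ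
  obtain ⟨j, f, β, h₁, h₂⟩ := IsCardinalPresentable.exists_hom_of_isColimit_of_family hcX
    (hY L.target) (cY.ι.app L.target ≫ θ.inv) hι (fun _ ↦ hX L.source) (fun _ ↦ L.hom)
    (fun _ ↦ 𝟙 _) (fun _ ↦ by simp [reassoc_of% L.w])
  obtain ⟨k, g, α, h₃, h₄⟩ := IsCardinalPresentable.exists_hom_of_isColimit_of_family hcY
    (hX j) (cX.ι.app j ≫ θ.hom) hι (fun _ ↦ hY L.target) (fun _ ↦ β)
    (fun _ ↦ 𝟙 _) (fun _ ↦ by simp [reassoc_of% h₁])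
  exact ⟨⟨j, k, α, h₃⟩, f, g, β, (h₂ ⟨⟩).trans (Category.id_comp _),
    (h₄ ⟨⟩).trans (Category.id_comp _)⟩

lemma exists_interleaving (L : CoconeLink cX cY θ.hom) :
    ∃ (M : ℕ ⥤ J) (N : ℕ ⥤ K) (f₀ : L.source ⟶ M.obj 0) (g₀ : L.target ⟶ N.obj 0)
      (α : M ⋙ X ⟶ N ⋙ Y) (β : ∀ n, Y.obj (N.obj n) ⟶ X.obj (M.obj (n + 1))),
      X.map f₀ ≫ α.app 0 = L.hom ≫ Y.map g₀ ∧
      (∀ n, α.app n ≫ cY.ι.app (N.obj n) = cX.ι.app (M.obj n) ≫ θ.hom) ∧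
      (∀ n, α.app n ≫ β n = (M ⋙ X).map (homOfLE (Nat.le_add_right n 1))) ∧
      (∀ n, β n ≫ α.app (n + 1) = (N ⋙ Y).map (homOfLE (Nat.le_add_right n 1))) := by
  choose next f g β h₁ h₂ using exists_next (θ := θ) hcX hcY hX hY
  let S (n : ℕ) : CoconeLink cX cY θ.hom := n.rec L (fun _ ↦ next)
  let M : ℕ ⥤ J := Functor.ofSequence (X := fun n ↦ (S n).source) (fun n ↦ f (S n))
  let N : ℕ ⥤ K := Functor.ofSequence (X := fun n ↦ (S n).target) (fun n ↦ g (S n))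
  have hM (n : ℕ) : (M ⋙ X).map (homOfLE (Nat.le_add_right n 1)) = (S n).hom ≫ β (S n) :=
    (X.congr_map (Functor.ofSequence_map_homOfLE_succ _ n)).trans (h₁ _).symm
  have hN (n : ℕ) : (N ⋙ Y).map (homOfLE (Nat.le_add_right n 1)) =
      β (S n) ≫ (S (n + 1)).hom :=
    (Y.congr_map (Functor.ofSequence_map_homOfLE_succ _ n)).trans (h₂ _).symm
  exact ⟨M, N, 𝟙 _, 𝟙 _,
    NatTrans.ofSequence (F := M ⋙ X) (G := N ⋙ Y) (fun n ↦ (S n).hom)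
      (fun n ↦ (hM n =≫ _).trans ((Category.assoc _ _ _).trans ((S n).hom ≫= (hN n).symm))),
    fun n ↦ β (S n),
    (X.map_id _ =≫ _).trans ((Category.id_comp _).trans
      ((Category.comp_id _).symm.trans (L.hom ≫= (Y.map_id _).symm))),
    fun n ↦ (S n).w, fun n ↦ (hM n).symm, fun n ↦ (hN n).symm⟩

end CoconeLink

end

end

section

variable {E : Type u} [Category.{v} E] {A : Type u₁} [Category.{v₁} A]
  {B : Type u₂} [Category.{v₂} B] (G : E ⥤ B) (U : A ⥤ B) (κ : Cardinal.{w})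
  [Fact κ.IsRegular] [IsCardinalAccessibleCategory E κ] [IsCardinalAccessibleCategory A κ]
  [G.IsCardinalAccessible κ] [U.IsCardinalAccessible κ]
  [HasColimitsOfShape ℕ E] [HasColimitsOfShape ℕ A]
  [PreservesColimitsOfShape ℕ G] [PreservesColimitsOfShape ℕ U]
  (hG : isCardinalPresentable E κ ≤ (isCardinalPresentable B κ).inverseImage G)
  (hU : isCardinalPresentable A κ ≤ (isCardinalPresentable B κ).inverseImage U)

/-- Uncountability of `κ` makes a sequential colimit `κ`-small. -/
lemma isCardinalPresentable_colimit_nat (hκ : ℵ₀ < κ) (F : ℕ ⥤ E)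
    (hF : ∀ n, IsCardinalPresentable (F.obj n) κ) :
    IsCardinalPresentable (colimit F) κ :=
  isCardinalPresentable_of_isColimit _ (colimit.isColimit F) κ (by
    have : Countable (Arrow ℕ) :=
      Function.Injective.countable (f := fun f : Arrow ℕ ↦ (f.left, f.right)) (by
        rintro ⟨a, b, f⟩ ⟨a', b', f'⟩ h
        obtain ⟨rfl, rfl⟩ := Prod.ext_iff.1 h
        obtain rfl := Subsingleton.elim f f'
        rfl)
    exact lt_of_le_of_lt (Cardinal.lift_le.2 (mk_le_aleph0 (α := Arrow ℕ))) (by simpa))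

include hG hU in
/-- Given an isomorphism between the images of objects `x` and `y` under functors `G` and `U`,
morphisms to `x` and `y` from `κ`-presentable objects can be factored through `κ`-presentable
objects over `x` and `y` with isomorphic images under `G` and `U`. -/
lemma exists_isCardinalPresentable_factorization (hκ : ℵ₀ < κ) {x : E} {y : A}
    (θ : G.obj x ≅ U.obj y) {e : E} (he : IsCardinalPresentable e κ) (f : e ⟶ x)
    {e' : A} (he' : IsCardinalPresentable e' κ) (f' : e' ⟶ y) {ι : Type w}
    (hι : HasCardinalLT ι κ) {V : ι → B} (hV : ∀ i, IsCardinalPresentable (V i) κ)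
    (d : ∀ i, V i ⟶ G.obj e) (d' : ∀ i, V i ⟶ U.obj e')
    (hd : ∀ i, d i ≫ G.map f ≫ θ.hom = d' i ≫ U.map f') :
    ∃ (p : E) (_ : IsCardinalPresentable p κ) (p' : A) (_ : IsCardinalPresentable p' κ)
      (φ : G.obj p ≅ U.obj p') (m : p ⟶ x) (m' : p' ⟶ y) (a : e ⟶ p) (a' : e' ⟶ p'),
      G.map m ≫ θ.hom = φ.hom ≫ U.map m' ∧ a ≫ m = f ∧ a' ≫ m' = f' ∧
      ∀ i, d i ≫ G.map a ≫ φ.hom = d' i ≫ U.map a' := by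
  let JE := CostructuredArrow (isCardinalPresentable E κ).ι x
  let JA := CostructuredArrow (isCardinalPresentable A κ).ι y
  have := Functor.preservesColimitsOfShape_of_isCardinalAccessible_of_essentiallySmall G κ JE
  have := Functor.preservesColimitsOfShape_of_isCardinalAccessible_of_essentiallySmall U κ JA
  let cE := (isCardinalPresentable E κ).canonicalCocone x
  let cA := (isCardinalPresentable A κ).canonicalCocone y
  have hcE : IsColimit cE := (isCardinalPresentable E κ).ι.denseAt x
  have hcA : IsColimit cA := (isCardinalPresentable A κ).ι.denseAt y
  have hGE := isColimitOfPreserves G hcE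
  have hUA := isColimitOfPreserves U hcA
  let θ' : (G.mapCocone cE).pt ≅ (U.mapCocone cA).pt := θ
  have hιE (j : JE) : cE.ι.app j = j.hom := Category.id_comp _
  have hιA (j : JA) : cA.ι.app j = j.hom := Category.id_comp _
  let j₀ : JE := ObjectProperty.costructuredArrowMk _ he f
  let k₀ : JA := ObjectProperty.costructuredArrowMk _ he' f'
  -- The initial link already respects the family `d`, `d'`; the chains built from it inherit this
  -- compatibility.
  obtain ⟨k₁, g, α, h₁, h₂⟩ := IsCardinalPresentable.exists_hom_of_isColimit_of_family hUA
    (hG _ he) (G.map f ≫ θ.hom) hι hV (k := k₀) d d'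
    (fun i ↦ (hd i).trans (d' i ≫= U.congr_map (hιA k₀).symm))
  let L : CoconeLink (G.mapCocone cE) (U.mapCocone cA) θ'.hom :=
    ⟨j₀, k₁, α, h₁.trans (G.congr_map (hιE j₀).symm =≫ θ.hom)⟩
  obtain ⟨M, N, f₀, g₀, τ, β, h₃, h₄, h₅, h₆⟩ := L.exists_interleaving hGE hUA
    (fun j ↦ hG _ j.left.property) (fun k ↦ hU _ k.left.property)
  let DE : ℕ ⥤ E := M ⋙ CostructuredArrow.proj _ x ⋙ (isCardinalPresentable E κ).ι
  let DA : ℕ ⥤ A := N ⋙ CostructuredArrow.proj _ y ⋙ (isCardinalPresentable A κ).ι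
  have hDE := colimit.isColimit DE
  have hDA := colimit.isColimit DA
  obtain ⟨φ, hφ⟩ := exists_iso_of_interleaving (M := DE ⋙ G) (N := DA ⋙ U) τ β h₅ h₆
    (isColimitOfPreserves G hDE) (isColimitOfPreserves U hDA)
  let φ : G.obj (colimit DE) ≅ U.obj (colimit DA) := φ
  have hφ (n : ℕ) : G.map (colimit.ι DE n) ≫ φ.hom = τ.app n ≫ U.map (colimit.ι DA n) := hφ n
  let m : colimit DE ⟶ x := colimit.desc DE (cE.whisker M)
  let m' : colimit DA ⟶ y := colimit.desc DA (cA.whisker N)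
  have hm (n : ℕ) : colimit.ι DE n ≫ m = cE.ι.app (M.obj n) := colimit.ι_desc (cE.whisker M) n
  have hm' (n : ℕ) : colimit.ι DA n ≫ m' = cA.ι.app (N.obj n) := colimit.ι_desc (cA.whisker N) n
  let a : e ⟶ DE.obj 0 := f₀.left.hom
  let a' : e' ⟶ DA.obj 0 := g.left.hom ≫ g₀.left.hom
  refine ⟨colimit DE, isCardinalPresentable_colimit_nat κ hκ DE fun n ↦ (M.obj n).left.property,
    colimit DA, isCardinalPresentable_colimit_nat κ hκ DA fun n ↦ (N.obj n).left.property,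
    φ, m, m', a ≫ colimit.ι DE 0, a' ≫ colimit.ι DA 0, ?_, ?_, ?_, fun i ↦ ?_⟩
  · refine (isColimitOfPreserves G hDE).hom_ext fun n ↦ ?_
    change G.map (colimit.ι DE n) ≫ G.map m ≫ θ.hom = G.map (colimit.ι DE n) ≫ φ.hom ≫ U.map m'
    rw [reassoc_of% (hφ n), ← U.map_comp, hm', ← G.map_comp_assoc, hm]
    exact (h₄ n).symm
  · rw [Category.assoc, hm, hιE]
    exact CostructuredArrow.w f₀
  · rw [Category.assoc, hm', hιA]
    exact (Category.assoc _ _ _).trans ((_ ≫= CostructuredArrow.w g₀).trans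
      (CostructuredArrow.w g))
  · have h₃ : G.map a ≫ τ.app 0 = α ≫ U.map g₀.left.hom := h₃
    have h₂ : d i ≫ α = d' i ≫ U.map g.left.hom := h₂ i
    have ha' : U.map a' = U.map g.left.hom ≫ U.map g₀.left.hom := U.map_comp _ _
    rw [G.map_comp, Category.assoc, hφ, reassoc_of% h₃, U.map_comp, ha']
    exact (congr_arg (d i ≫ ·) (Category.assoc _ _ _)).trans
      (((reassoc_of% h₂) _).trans
        ((Category.assoc _ _ _).trans (d' i ≫= (Category.assoc _ _ _).symm)))

end

end CategoryTheory

/-! ### Accessibility of a pulled back wide subcategory -/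

namespace CategoryTheory.WideSubcategory

open Cardinal

variable {E : Type u₁} [Category.{v₁} E] {B : Type u₂} [Category.{v₂} B] {G : E ⥤ B}
  {W : MorphismProperty B} [W.IsMultiplicative] {W' : MorphismProperty E} [W'.IsMultiplicative]
  (h : W' = W.inverseImage G) (hW : MorphismProperty.isomorphisms B ≤ W)
  (κ : Cardinal.{w}) [Fact κ.IsRegular]

/-- The objects of a pulled back wide subcategory which become `κ`-presentable in both
factors of the pullback. -/
abbrev isCardinalPresentableInFactors : ObjectProperty (WideSubcategory W') :=
  (isCardinalPresentable E κ).inverseImage (wideSubcategoryInclusion W') ⊓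
    (isCardinalPresentable (WideSubcategory W) κ).inverseImage (map G h.le)

include hW in
lemma essentiallySmall_isCardinalPresentableInFactors [HasCardinalFilteredGenerator E κ] :
    ObjectProperty.EssentiallySmall.{w} (isCardinalPresentableInFactors h κ) := by
  obtain ⟨Q, _, hQ⟩ :=
    ObjectProperty.EssentiallySmall.exists_small_le' (isCardinalPresentable E κ)
  refine ⟨.ofObj (fun a : Subtype Q ↦ (⟨a.1⟩ : WideSubcategory W')), inferInstance,
    fun f hf ↦ ?_⟩
  obtain ⟨a, ha, ⟨e⟩⟩ := hQ _ hf.1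
  have he : W (G.map e.hom) := hW _ (inferInstanceAs (IsIso (G.map e.hom)))
  have he' : W (G.map e.inv) := hW _ (inferInstanceAs (IsIso (G.map e.inv)))
  exact ⟨⟨a⟩, ObjectProperty.ofObj_apply
    (fun a : Subtype Q ↦ (⟨a.1⟩ : WideSubcategory W')) ⟨a, ha⟩,
    ⟨WideSubcategory.isoMk e (h.ge _ he) (h.ge _ he')⟩⟩

section

variable [HasCardinalFilteredColimits E κ] [HasCardinalFilteredColimits (WideSubcategory W) κ]
  [G.IsCardinalAccessible κ] [(wideSubcategoryInclusion W).IsCardinalAccessible κ]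

include hW in
-- A morphism to a colimit factors through a stage in each factor. The two factorizations agree in
-- `B` at a later stage, since `G.obj p.obj` is presentable; there the factorization in `E` lies in
-- `W'`.
lemma isCardinalPresentableInFactors_le
    (hG : isCardinalPresentable E κ ≤ (isCardinalPresentable B κ).inverseImage G) :
    isCardinalPresentableInFactors h κ ≤ isCardinalPresentable (WideSubcategory W') κ := by
  rintro p ⟨h₁, h₂⟩
  have h₁ : IsCardinalPresentable p.obj κ := h₁
  have h₂ : IsCardinalPresentable ((map G h.le).obj p) κ := h₂
  have h₃ : IsCardinalPresentable (G.obj p.obj) κ := hG _ h₁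
  refine IsCardinalPresentable.mk_of_exists (fun {J _ _ K c} hc f ↦ ?_)
    fun {J _ _ K c} hc j f g hfg ↦ ?_
  all_goals
    have := isFiltered_of_isCardinalFiltered J κ
    have := HasCardinalFilteredColimits.hasColimitsOfShape E (κ := κ) J
    have := HasCardinalFilteredColimits.hasColimitsOfShape (WideSubcategory W) (κ := κ) J
    have := G.preservesColimitsOfShape_of_isCardinalAccessible κ J
    have := (wideSubcategoryInclusion W).preservesColimitsOfShape_of_isCardinalAccessible κ J
    have := preservesColimitsOfShape_inclusion_of_eq_inverseImage h J hW
    have hE := isColimitOfPreserves (wideSubcategoryInclusion W') hc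
  · have := preservesColimitsOfShape_map_of_eq_inverseImage h J hW
    have hA := isColimitOfPreserves (map G h.le) hc
    obtain ⟨j₁, (g₁ : p.obj ⟶ (K.obj j₁).obj), (hg₁ : g₁ ≫ (c.ι.app j₁).1 = f.1)⟩ :=
      IsCardinalPresentable.exists_hom_of_isColimit κ hE f.1
    obtain ⟨j₂, g₂, hg₂⟩ :=
      IsCardinalPresentable.exists_hom_of_isColimit κ hA ((map G h.le).map f)
    have hg₂ : g₂.1 ≫ G.map (c.ι.app j₂).1 = G.map f.1 :=
      congr_arg InducedWideCategory.Hom.hom hg₂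
    obtain ⟨k, a, b, (hab : G.map g₁ ≫ G.map (K.map a).1 = g₂.1 ≫ G.map (K.map b).1)⟩ :=
      IsCardinalPresentable.exists_eq_of_isColimit κ
        (isColimitOfPreserves (wideSubcategoryInclusion W) hA) (G.map g₁) g₂.1
        (((G.map_comp _ _).symm.trans (G.congr_map hg₁)).trans hg₂.symm)
    have hk : W (G.map (g₁ ≫ (K.map a).1)) := by
      rw [G.map_comp, hab]
      exact (g₂ ≫ (map G h.le).map (K.map b)).2
    refine ⟨k, ⟨g₁ ≫ (K.map a).1, h.ge _ hk⟩, WideSubcategory.hom_ext _ ?_⟩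
    have := congr_arg InducedWideCategory.Hom.hom (c.w a)
    exact (Category.assoc _ _ _).trans ((g₁ ≫= this).trans hg₁)
  · obtain ⟨k, a, ha⟩ := IsCardinalPresentable.exists_eq_of_isColimit' κ hE f.1 g.1
      (congr_arg InducedWideCategory.Hom.hom hfg)
    exact ⟨k, a, WideSubcategory.hom_ext _ ha⟩

end

variable [IsCardinalAccessibleCategory E κ] [IsCardinalAccessibleCategory (WideSubcategory W) κ]
  [G.IsCardinalAccessible κ] [(wideSubcategoryInclusion W).IsCardinalAccessible κ]
  [HasColimitsOfShape ℕ E] [HasColimitsOfShape ℕ (WideSubcategory W)]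
  [PreservesColimitsOfShape ℕ G] [PreservesColimitsOfShape ℕ (wideSubcategoryInclusion W)]
  (hG : isCardinalPresentable E κ ≤ (isCardinalPresentable B κ).inverseImage G)
  (hU : isCardinalPresentable (WideSubcategory W) κ ≤
    (isCardinalPresentable B κ).inverseImage (wideSubcategoryInclusion W))
  (hκ : ℵ₀ < κ)

include hW hG hU hκ

/-- The back-and-forth factorization is applied to the identity of `G.obj x.obj`. The isomorphism
`φ` lies in `W`, so the object `p` found in `E` has image isomorphic to `p'` in the wide subcategory
of `W`, hence presentable there. -/
lemma jointlyRefines : JointlyRefines (wideSubcategoryInclusion W') (map G h.le)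
    (isCardinalPresentableInFactors h κ) κ where
  exists_refinement {J hJ K hK x} f {e} he {e'} he' d d' u hu u' hu' := by
    obtain ⟨p, hp, p', hp', φ, m, m', a, a', h₁, h₂, h₃, h₄⟩ :=
      exists_isCardinalPresentable_factorization G (wideSubcategoryInclusion W) κ hG hU hκ
        (x := x.obj) (y := (map G h.le).obj x) (Iso.refl _) he u he' u' hJ
        (V := fun j ↦ G.obj (K j).obj) (fun j ↦ hG _ (hK j).1) (fun j ↦ G.map (d j))
        (fun j ↦ (d' j).1) (fun j ↦ by
          have h₁ := G.congr_map (hu j)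
          have h₂ := congr_arg InducedWideCategory.Hom.hom (hu' j)
          rw [G.map_comp] at h₁
          exact ((_ ≫= Category.comp_id _).trans h₁).trans h₂.symm)
    have hφ₁ : W φ.hom := hW _ (inferInstanceAs (IsIso φ.hom))
    have hφ₂ : W φ.inv := hW _ (inferInstanceAs (IsIso φ.inv))
    let P : WideSubcategory W' := ⟨p⟩
    let ψ : (map G h.le).obj P ≅ p' := WideSubcategory.isoMk φ hφ₁ hφ₂
    have h₁ : G.map m = φ.hom ≫ m'.1 := (Category.comp_id _).symm.trans h₁
    have h₄ (j : J) : G.map (d j ≫ a) = (d' j ≫ a' ≫ ψ.inv).1 := by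
      have h₄ : (G.map (d j) ≫ G.map a) ≫ φ.hom = (d' j).1 ≫ a'.1 :=
        (Category.assoc _ _ _).trans (h₄ j)
      rw [G.map_comp]
      exact (Iso.eq_comp_inv φ).2 h₄ |>.trans (Category.assoc _ _ _)
    have hm : W (G.map m) := by
      rw [h₁]
      exact W.comp_mem _ _ hφ₁ m'.2
    have hq (j : J) : W (G.map (d j ≫ a)) := by
      rw [h₄]
      exact (d' j ≫ a' ≫ ψ.inv).2
    refine ⟨P, ⟨hp, ?_⟩, fun j ↦ ⟨d j ≫ a, h.ge _ (hq j)⟩, ⟨m, h.ge _ hm⟩, a, a' ≫ ψ.inv,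
      fun j ↦ rfl, fun j ↦ WideSubcategory.hom_ext _ (h₄ j), h₂, ?_⟩
    · exact (isCardinalPresentable (WideSubcategory W) κ).prop_of_iso ψ.symm hp'
    · refine Eq.trans ?_ h₃
      have : (map G h.le).map (⟨m, h.ge _ hm⟩ : P ⟶ x) = ψ.hom ≫ m' :=
        WideSubcategory.hom_ext _ h₁
      rw [this]
      simp

include h in
lemma isCardinalAccessibleCategory : IsCardinalAccessibleCategory (WideSubcategory W') κ := by
  have : LocallySmall.{w} (WideSubcategory W') :=
    locallySmall_of_faithful (wideSubcategoryInclusion W')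
  have : HasCardinalFilteredColimits (WideSubcategory W') κ := ⟨fun J _ _ ↦
    have := HasCardinalFilteredColimits.hasColimitsOfShape E (κ := κ) J
    have := HasCardinalFilteredColimits.hasColimitsOfShape (WideSubcategory W) (κ := κ) J
    have := G.preservesColimitsOfShape_of_isCardinalAccessible κ J
    have := (wideSubcategoryInclusion W).preservesColimitsOfShape_of_isCardinalAccessible κ J
    hasColimitsOfShape_of_eq_inverseImage h J hW⟩
  have := essentiallySmall_isCardinalPresentableInFactors h hW κ
  refine (jointlyRefines h hW κ hG hU hκ).isCardinalAccessibleCategory inf_le_left inf_le_right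
    (fun f g h₁ _ ↦ WideSubcategory.hom_ext _ h₁)
    (isCardinalPresentableInFactors_le h hW κ hG) fun {J _ _ _ K} c h₁ h₂ ↦ ?_
  have := G.preservesColimitsOfShape_of_isCardinalAccessible_of_essentiallySmall κ J
  exact ⟨isColimitOfMap h h₁ h₂⟩

end CategoryTheory.WideSubcategory

/-! ### Lifting the union property and accessibility -/

namespace IndependenceRelation

variable {𝒞 : Type u₁} [Category.{v₁} 𝒞] {𝒟 : Type u₂} [Category.{v₂} 𝒟]
  (F : 𝒞 ⥤ 𝒟) (I : IndependenceRelation 𝒟)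

/-- The commutativity clause in `lift` is automatic for morphisms of arrows. -/
lemma lift_squares : (I.lift F).squares = I.squares.inverseImage F.mapArrow := by
  ext f g φ
  exact ⟨fun h ↦ h.2, fun h ↦ ⟨⟨φ.w.symm⟩, h⟩⟩

lemma isomorphisms_le_squares [I.BasicExistence] :
    MorphismProperty.isomorphisms (Arrow 𝒟) ≤ I.squares := by
  intro f g φ (_ : IsIso φ)
  exact BasicExistence.indep ⟨(Arrow.w φ).symm⟩ (Or.inl inferInstance)

variable [I.BasicExistence] [I.Transitivity]

lemma Union.lift [HasDirectedColimits.{w} 𝒞] [PreservesDirectedColimits.{w} F]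
    {I : IndependenceRelation 𝒟} [I.BasicExistence] [I.Transitivity] (hI : Union.{w} I) :
    Union.{w} (I.lift F) := by
  obtain ⟨_, _⟩ := hI
  refine ⟨⟨fun J _ _ _ ↦ ?_⟩, ⟨fun J _ _ _ ↦ ?_⟩⟩
  all_goals
    have := HasDirectedColimits.hasColimitsOfShape (C := Arrow 𝒞) J
    have := HasDirectedColimits.hasColimitsOfShape (C := I.Cat) J
    have := PreservesDirectedColimits.preservesColimitsOfShape (F := F.mapArrow) J
    have := PreservesDirectedColimits.preservesColimitsOfShape (F := I.inclusion) J
  · exact WideSubcategory.hasColimitsOfShape_of_eq_inverseImage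
      (I.lift_squares F) J I.isomorphisms_le_squares
  · exact WideSubcategory.preservesColimitsOfShape_inclusion_of_eq_inverseImage
      (I.lift_squares F) J I.isomorphisms_le_squares

lemma Accessible.lift [IsAccessibleCategory.{w} 𝒞] [HasDirectedColimits.{w} 𝒞]
    [IsAccessibleCategory.{w} 𝒟] [PreservesDirectedColimits.{w} F]
    {I : IndependenceRelation 𝒟} [I.BasicExistence] [I.Transitivity]
    (hI : Accessible.{w} I) (hI' : Union.{w} I) : Accessible.{w} (I.lift F) := by
  obtain ⟨_, _⟩ := hI'
  have : IsAccessibleCategory.{w} I.Cat := hI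
  obtain ⟨κ₁, h₁⟩ := exists_cardinal_forall_isCardinalPresentable_le_inverseImage.{w} F.mapArrow
  obtain ⟨κ₂, h₂⟩ := exists_cardinal_forall_isCardinalPresentable_le_inverseImage.{w} I.inclusion
  -- A successor of an infinite cardinal is regular and uncountable, so `Order.succ μ` meets both
  -- bounds and the requirement `ℵ₀ < κ`.
  let μ : Cardinal.{w} := max (max κ₁ κ₂) Cardinal.aleph0
  have hμ : Cardinal.aleph0 ≤ μ := le_max_right _ _
  have hκ : μ < Order.succ μ := Order.lt_succ μ
  have : Fact (Order.succ μ).IsRegular := ⟨Cardinal.isRegular_succ hμ⟩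
  obtain ⟨_, hG⟩ := h₁ (Order.succ μ) (((le_max_left _ _).trans (le_max_left _ _)).trans hκ.le)
    (hμ.trans_lt hκ)
  obtain ⟨_, hU⟩ := h₂ (Order.succ μ) (((le_max_right _ _).trans (le_max_left _ _)).trans hκ.le)
    (hμ.trans_lt hκ)
  have := PreservesDirectedColimits.isCardinalAccessible F.mapArrow (Order.succ μ)
  have := PreservesDirectedColimits.isCardinalAccessible I.inclusion (Order.succ μ)
  have := HasDirectedColimits.hasColimitsOfShape_of_isFiltered (C := Arrow 𝒞) ℕ
  have := HasDirectedColimits.hasColimitsOfShape_of_isFiltered (C := I.Cat) ℕ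
  have := PreservesDirectedColimits.preservesColimitsOfShape_of_isFiltered F.mapArrow ℕ
  have := PreservesDirectedColimits.preservesColimitsOfShape_of_isFiltered I.inclusion ℕ
  exact ⟨Order.succ μ, inferInstance, WideSubcategory.isCardinalAccessibleCategory
    (I.lift_squares F) I.isomorphisms_le_squares _ hG hU (hμ.trans_lt hκ)⟩

end IndependenceRelation

theorem mainTheorem5 {𝒞 : Type u₁} [Category.{v₁} 𝒞] {𝒟 : Type u₂} [Category.{v₂} 𝒟]
    [IsAccessibleCategory.{w} 𝒞] [HasDirectedColimits.{w} 𝒞]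
    [IsAccessibleCategory.{w} 𝒟] [HasDirectedColimits.{w} 𝒟]
    (F : 𝒞 ⥤ 𝒟) [PreservesDirectedColimits.{w} F]
    (I : IndependenceRelation 𝒟) [I.BasicExistence] [I.Transitivity] :
    (IndependenceRelation.Union.{w} I → IndependenceRelation.Union.{w} (I.lift F)) ∧
    (IndependenceRelation.Union.{w} I ∧ IndependenceRelation.Accessible.{w} I →
      IndependenceRelation.Union.{w} (I.lift F) ∧
      IndependenceRelation.Accessible.{w} (I.lift F)) :=
  ⟨fun h ↦ h.lift F, fun h ↦ ⟨h.1.lift F, h.2.lift F h.1⟩⟩
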